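/- Let $\{p_{\theta,\eta}:\theta\in\Theta,\ \eta\in\mathcal H\}$ be probability densities on a sample space $\mathcal X$ with respect to a measure $\mu$, where $\Theta\subset\mathbb R$ is compact and $\mathcal H$ is an arbitrary subset of a normed space. Let $X_1,X_2,\dots$ be i.i.d. from $P=P_{\theta_0,\eta_0}$ with $\theta_0$ interior to $\Theta$ and $\eta_0\in\mathcal H$; write $\mathbb P_n$ for the empirical measure and $\mathbb G_n=\sqrt n(\mathbb P_n-P)$, and take stochastic orders in outer probability. Let $\mathrm{lik}_n(\theta,\eta)=\prod_{i\le n}p_{\theta,\eta}(X_i)$ and $pl_n(\theta)=\sup_{\eta\in\mathcal H}\mathrm{lik}_n(\theta,\eta)$. Almost surely for all large $n$, let $\hat\eta_\theta$ maximise $\mathrm{lik}_n(\theta,\cdot)$ over $\mathcal H$ for every $\theta\in\Theta$, and let $\hat\theta_n$ maximise $pl_n$ over $\Theta$. Put $\Delta_n(\theta)=n^{-1}\{\log pl_n(\theta)-\log pl_n(\hat\theta_n)\}$. The ordinary score $\partial_\theta\log p_{\theta,\eta_0}|_{\theta=\theta_0}$ is assumed to exist and to lie in $L_2(P)$. The nuisance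 scores are the derivatives at $s=0$ of $\log p_{\theta_0,\eta_s}$ along the members of a given collection of paths $\eta_s\in\mathcal H$ through $\eta_0$, and lie in $L_2^0(P)$. The efficient score $\tilde\ell_0$ is the ordinary score minus its projection on the closed linear span of the nuisance scores in $L_2(P)$, and $\tilde I_0$ is the variance of $\tilde\ell_0$ under $P$. Let $t\mapsto\eta_t(\theta,\eta)$ be a map with values in $\mathcal H$ for $(t,\theta,\eta)$ near $(\theta_0,\theta_0,\eta_0)$. Put $\ell(t,\theta,\eta)=\log p_{t,\eta_t(\theta,\eta)}$, with $t$-derivatives $\dot\ell,\ddot\ell,\ell^{(3)}$ and $\ell_{t,\theta}=\partial_\theta\dot\ell$; write $\dot\ell_0,\ddot\ell_0$ for values at $(\theta_0,\theta_0,\eta_0)$. Assume: 1. (Least favorable submodel) $\eta_\theta(\theta,\eta)=\eta$ for all $(\theta,\eta)\in\Theta\times\mathcal H$, and $\dot\ell_0=\tilde\ell_0$ $P$-a.s. 2. $\|\hat\eta_{\tilde\theta_n}-\eta_0\|=O_P(n^{-1/2}+|\tilde\theta_n-\theta_0|)$ for every random sequence $\tilde\theta_n\in\Theta$ (a function of the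 data) with $\tilde\theta_n=\theta_0+o_P(1)$. 3. For $P$-almost every $x$, in a neighbourhood of $(\theta_0,\theta_0,\eta_0)$ in $\Theta\times\Theta\times\mathcal H$, $p_{t,\eta_t(\theta,\eta)}(x)>0$ and the derivatives $\partial^{l+m}\ell/\partial t^l\partial\theta^m$ exist and are bounded by a $P$-integrable envelope, for $(l,m)=(0,0),(1,0),(2,0),(3,0),(1,1),(1,2),(2,1)$. Moreover $\int p_{t,\eta_t(\theta,\eta_0)}\,d\mu=1$ may be differentiated under the integral sign near $(\theta_0,\theta_0)$: there, for $\mu$-almost every $x$, the density $p_{t,\eta_t(\theta,\eta_0)}(x)$ vanishes whenever $p_{\theta_0,\eta_0}(x)$ does, and its derivatives $\partial^{l+m}/\partial t^l\partial\theta^m$, $(l,m)=(1,0),(2,0),(1,1)$, exist and have a $\mu$-integrable envelope. 4. For $V$ a neighbourhood of $(\theta_0,\theta_0,\eta_0)$ in $\Theta\times\Theta\times\mathcal H$, the classes $\{\ddot\ell(v):v\in V\}$ and $\{\ell_{t,\theta}(v):v\in V\}$ are $P$-Donsker and $\{\ell^{(3)}(v):v\in V\}$ is $P$-Glivenko–Cantelli.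 5. Uniformly for $\eta\in\mathcal H$ in a neighbourhood of $\eta_0$: $\mathbb G_n(\dot\ell(\theta_0,\theta_0,\eta)-\dot\ell_0)=O_P(\|\eta-\eta_0\|)$; $P\ddot\ell(\theta_0,\theta_0,\eta)-P\ddot\ell_0=O(\|\eta-\eta_0\|)$; $P\ell_{t,\theta}(\theta_0,\theta_0,\eta)-P\ell_{t,\theta}(\theta_0,\theta_0,\eta_0)=O(\|\eta-\eta_0\|)$; $P\dot\ell(\theta_0,\theta_0,\eta)=O(\|\eta-\eta_0\|^2)$. 6. $\tilde I_0>0$. 7. (Identifiability) For every random sequence $\tilde\theta_n\in\Theta$ (a function of the data), $\Delta_n(\tilde\theta_n)=o_P(1)$ implies $\tilde\theta_n=\theta_0+o_P(1)$. Let $\rho$ be a probability density on $\Theta$ (a proper prior) with $\rho(\theta_0)>0$ that is continuously differentiable in a neighbourhood of $\theta_0$, and let $\tilde P_{\theta|\tilde X}$ be the posterior profile distribution, the distribution on $\Theta$ with density proportional to $\rho(\theta)\,pl_n(\theta)$. Then, with $\Phi$ the standard normal distribution function, $$\sup_{\xi\in\mathbb R}\Big|\tilde P_{\theta|\tilde X}\big(\sqrt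 n(\theta-\hat\theta_n)\tilde I_0^{1/2}\le\xi\big)-\Phi(\xi)\Big|=O_P(n^{-1/2}).$$ -/

import Mathlib

open MeasureTheory ProbabilityTheory Filter Topology Set
open scoped ENNReal NNReal

noncomputable section

/-! ### Stochastic orders along i.i.d. samples

A statistic is a function of the sample `x : Fin n → 𝒳`. Probabilities of arbitrary events are outer
probabilities (a measure applied to a non-measurable set is its outer measure). -/

section StochasticOrder

variable {𝒳 : Type*} [MeasurableSpace 𝒳]

/-- The law of an i.i.d. sample of size `n` from `P`. -/
def sampleLaw (P : Measure 𝒳) (n : ℕ) : Measure (Fin n → 𝒳) :=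
  Measure.pi fun _ => P

/-- `Z_n = O_P(R_n)` in outer probability, `R_n` being a nonnegative, possibly random, rate. -/
def IsBigOP (P : Measure 𝒳) (Z : (n : ℕ) → (Fin n → 𝒳) → ℝ≥0∞)
    (R : (n : ℕ) → (Fin n → 𝒳) → ℝ) : Prop :=
  ∀ ε : ℝ, 0 < ε → ∃ M : ℝ, 0 < M ∧ ∀ᶠ n in atTop,
    sampleLaw P n {x | ENNReal.ofReal (M * R n x) < Z n x} ≤ ENNReal.ofReal ε

/-- `Z_n = o_P(1)` in outer probability. -/
def IsLittleOP (P : Measure 𝒳) (Z : (n : ℕ) → (Fin n → 𝒳) → ℝ≥0∞) : Prop :=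
  ∀ ε : ℝ, 0 < ε →
    Tendsto (fun n => sampleLaw P n {x | ENNReal.ofReal ε < Z n x}) atTop (𝓝 0)

/-- The empirical mean `ℙ_n f`. -/
def empMean (n : ℕ) (x : Fin n → 𝒳) (f : 𝒳 → ℝ) : ℝ :=
  (n : ℝ)⁻¹ * ∑ i, f (x i)

/-- The empirical process `𝔾_n f = n^{-1/2} ∑ (f (X_i) - P f)`. -/
def empGn (P : Measure 𝒳) (n : ℕ) (x : Fin n → 𝒳) (f : 𝒳 → ℝ) : ℝ :=
  (√(n : ℝ))⁻¹ * ∑ i, (f (x i) - ∫ y, f y ∂P)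

/-- The outer expectation of a bounded function. -/
def outerExp {Ω : Type*} [MeasurableSpace Ω] (Q : Measure Ω) (f : Ω → ℝ) : ℝ :=
  sInf {r | ∃ U : Ω → ℝ, Measurable U ∧ Integrable U Q ∧ (∀ ω, f ω ≤ U ω) ∧ r = ∫ ω, U ω ∂Q}

end StochasticOrder

/-! ### Donsker and Glivenko–Cantelli classes -/

/-- `ℓ^∞(T)`, the bounded real functions on `T` with the supremum norm. -/
abbrev LInfty (T : Type*) : Type _ := lp (fun _ : T => ℝ) ∞

instance instMeasurableSpaceLInfty (T : Type*) : MeasurableSpace (LInfty T) := borel _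

instance instBorelSpaceLInfty (T : Type*) : BorelSpace (LInfty T) := ⟨rfl⟩

open Classical in
/-- A bounded function as an element of `ℓ^∞(T)` (unbounded functions are sent to `0`). -/
def toLInfty {T : Type*} (z : T → ℝ) : LInfty T :=
  if h : Memℓp z ∞ then ⟨z, h⟩ else 0

section Classes

variable {𝒳 : Type*} [MeasurableSpace 𝒳]

/-- `F` is `P`-Donsker: the sample paths `f ↦ 𝔾_n f` are (almost surely) bounded on `F`, and `𝔾_n`
converges weakly in `ℓ^∞(F)`, in the sense of outer expectations of bounded continuous functions,
to a tight Borel law. -/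
def IsDonsker (P : Measure 𝒳) (F : Set (𝒳 → ℝ)) : Prop :=
  (∀ f ∈ F, MemLp f 2 P) ∧
  (∀ᵐ x ∂P, BddAbove (range fun f : F => |(f : 𝒳 → ℝ) x - ∫ y, (f : 𝒳 → ℝ) y ∂P|)) ∧
  ∃ L : Measure (LInfty F), IsProbabilityMeasure L ∧ IsTightMeasureSet {L} ∧
    ∀ h : BoundedContinuousFunction (LInfty F) ℝ,
      Tendsto (fun n => outerExp (sampleLaw P n) fun x =>
          h (toLInfty fun f : F => empGn P n x f))
        atTop (𝓝 (∫ z, h z ∂L))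

/-- `F` is `P`-Glivenko–Cantelli: `sup_{f ∈ F} |ℙ_n f - P f| → 0` in outer probability. -/
def IsGlivenkoCantelli (P : Measure 𝒳) (F : Set (𝒳 → ℝ)) : Prop :=
  (∀ f ∈ F, Integrable f P) ∧
  IsLittleOP P fun n x => ⨆ f ∈ F, ENNReal.ofReal |empMean n x f - ∫ y, f y ∂P|

end Classes

/-! ### Mixed partial derivatives in `(t, θ)` -/

/-- `∂^{l+m} f / ∂t^l ∂θ^m` at `(t, θ)`. -/
def mixedDeriv (l m : ℕ) (f : ℝ → ℝ → ℝ) (t θ : ℝ) : ℝ :=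
  iteratedDeriv m (fun θ' => iteratedDeriv l (fun t' => f t' θ') t) θ

/-- The last differentiation in `mixedDeriv l m f t θ` is a genuine one. -/
def MixedDiffAt (f : ℝ → ℝ → ℝ) (t θ : ℝ) : ℕ → ℕ → Prop
  | 0, 0 => True
  | l + 1, 0 => DifferentiableAt ℝ (fun t' => mixedDeriv l 0 f t' θ) t
  | l, m + 1 => DifferentiableAt ℝ (fun θ' => mixedDeriv l m f t θ') θ

/-! ### Semiparametric models, efficient score, profile likelihood -/

/-- A semiparametric model: probability densities `p θ η` with respect to a dominating measure,
indexed by a real parameter `θ ∈ Θ` and a nuisance parameter `η` in an arbitrary subset `H` of a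
normed space. Values of `p` off `Θ × H` play no role. -/
structure SemiparametricModel (𝒳 : Type*) [MeasurableSpace 𝒳] (E : Type*)
    [NormedAddCommGroup E] where
  /-- the dominating measure -/
  μ : Measure 𝒳
  /-- the set of values of the parameter of interest -/
  Θ : Set ℝ
  /-- the set of values of the nuisance parameter -/
  H : Set E
  /-- the density -/
  p : ℝ → E → 𝒳 → ℝ≥0
  measurable_p : ∀ θ ∈ Θ, ∀ η ∈ H, Measurable (p θ η)
  lintegral_p : ∀ θ ∈ Θ, ∀ η ∈ H, ∫⁻ x, p θ η x ∂μ = 1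

namespace SemiparametricModel

variable {𝒳 : Type*} [MeasurableSpace 𝒳] {E : Type*} [NormedAddCommGroup E]

/-- The distribution with density `p θ η`. -/
def P (M : SemiparametricModel 𝒳 E) (θ : ℝ) (η : E) : Measure 𝒳 :=
  M.μ.withDensity fun x => (M.p θ η x : ℝ≥0∞)

/-- The log-likelihood of one observation. -/
def logLik (M : SemiparametricModel 𝒳 E) (θ : ℝ) (η : E) (x : 𝒳) : ℝ :=
  Real.log (M.p θ η x)

/-- The ordinary score function for `θ`. -/
def score (M : SemiparametricModel 𝒳 E) (θ : ℝ) (η : E) (x : 𝒳) : ℝ :=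
  deriv (fun θ' => M.logLik θ' η x) θ

/-- The score at `(θ, γ 0)` for the nuisance parameter along the path `γ`. -/
def nuisanceScore (M : SemiparametricModel 𝒳 E) (θ : ℝ) (γ : ℝ → E) (x : 𝒳) : ℝ :=
  deriv (fun s => M.logLik θ (γ s) x) 0

/-- `γ` is a path in `H` that approaches `η`, along which the log-likelihood is differentiable, with
a score in `L_2^0(P_{θ,η})`. -/
structure IsNuisancePath (M : SemiparametricModel 𝒳 E) (θ : ℝ) (η : E) (γ : ℝ → E) : Prop where
  start : γ 0 = η
  tendsto : Tendsto γ (𝓝 0) (𝓝 η)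
  mem : ∀ᶠ s in 𝓝 (0 : ℝ), γ s ∈ M.H
  diff : ∀ᵐ x ∂M.P θ η, (∀ᶠ s in 𝓝 (0 : ℝ), 0 < M.p θ (γ s) x) ∧
    DifferentiableAt ℝ (fun s => M.logLik θ (γ s) x) 0
  memLp : MemLp (M.nuisanceScore θ γ) 2 (M.P θ η)
  mean_zero : ∫ x, M.nuisanceScore θ γ x ∂M.P θ η = 0

/-- The closed linear span in `L_2(P_{θ,η})` of the nuisance scores along the paths in `D`. -/
def nuisanceTangentSpace (M : SemiparametricModel 𝒳 E) (θ : ℝ) (η : E) (D : Set (ℝ → E)) :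
    Submodule ℝ (Lp ℝ 2 (M.P θ η)) :=
  (Submodule.span ℝ {g : Lp ℝ 2 (M.P θ η) |
    ∃ γ ∈ D, g =ᵐ[M.P θ η] M.nuisanceScore θ γ}).topologicalClosure

instance instProjNuisanceTangentSpace (M : SemiparametricModel 𝒳 E) (θ : ℝ) (η : E)
    (D : Set (ℝ → E)) : (M.nuisanceTangentSpace θ η D).HasOrthogonalProjection := by
  unfold nuisanceTangentSpace
  infer_instance

open Classical in
/-- The ordinary score as an element of `L_2(P_{θ,η})` (it is always used with the assumption that
it is square-integrable). -/
def scoreLp (M : SemiparametricModel 𝒳 E) (θ : ℝ) (η : E) : Lp ℝ 2 (M.P θ η) :=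
  if h : MemLp (M.score θ η) 2 (M.P θ η) then h.toLp else 0

/-- The efficient score: the ordinary score minus its projection on the closed linear span of the
nuisance scores. -/
def efficientScore (M : SemiparametricModel 𝒳 E) (θ : ℝ) (η : E) (D : Set (ℝ → E)) :
    Lp ℝ 2 (M.P θ η) :=
  M.scoreLp θ η - (M.nuisanceTangentSpace θ η D).starProjection (M.scoreLp θ η)

/-- The efficient information: the variance of the efficient score. -/
def efficientInfo (M : SemiparametricModel 𝒳 E) (θ : ℝ) (η : E) (D : Set (ℝ → E)) : ℝ :=
  variance (M.efficientScore θ η D) (M.P θ η)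

/-- The full likelihood of a sample. -/
def lik (M : SemiparametricModel 𝒳 E) (n : ℕ) (x : Fin n → 𝒳) (θ : ℝ) (η : E) : ℝ≥0 :=
  ∏ i, M.p θ η (x i)

/-- The profile likelihood `pl_n(θ) = sup_{η ∈ H} lik_n(θ, η)`. -/
def profileLik (M : SemiparametricModel 𝒳 E) (n : ℕ) (x : Fin n → 𝒳) (θ : ℝ) : ℝ≥0∞ :=
  ⨆ η ∈ M.H, (M.lik n x θ η : ℝ≥0∞)

/-- `Δ_n(θ) = n⁻¹ (log pl_n(θ) - log pl_n(θhat))`, where `log 0 = -∞`. -/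
def profileDelta (M : SemiparametricModel 𝒳 E) (n : ℕ) (x : Fin n → 𝒳) (θhat θ : ℝ) : EReal :=
  (ENNReal.log (M.profileLik n x θ) - ENNReal.log (M.profileLik n x θhat)) / (n : EReal)

/-- The posterior profile distribution of `θ` for the prior density `ρ` on `Θ`: the distribution on
`Θ` with density proportional to `ρ · pl_n`. -/
def posteriorProfile (M : SemiparametricModel 𝒳 E) (ρ : ℝ → ℝ≥0) (n : ℕ) (x : Fin n → 𝒳) :
    Measure ℝ :=
  (∫⁻ θ in M.Θ, (ρ θ : ℝ≥0∞) * M.profileLik n x θ)⁻¹ •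
    (volume.restrict M.Θ).withDensity fun θ => (ρ θ : ℝ≥0∞) * M.profileLik n x θ

/-! ### The least favorable submodel and the standing assumptions -/

/-- `ℓ(t, θ, η)(x) = log lik(t, η_t(θ, η))(x)`, as a function of `(t, θ)`, where
`sub t θ η = η_t(θ, η)`. -/
def subLogLik (M : SemiparametricModel 𝒳 E) (sub : ℝ → ℝ → E → E) (η : E) (x : 𝒳) (t θ : ℝ) : ℝ :=
  M.logLik t (sub t θ η) x

/-- `∂^{l+m} ℓ(t, θ, η)(x) / ∂t^l ∂θ^m`. -/
def ell (M : SemiparametricModel 𝒳 E) (sub : ℝ → ℝ → E → E) (l m : ℕ) (t θ : ℝ) (η : E)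
    (x : 𝒳) : ℝ :=
  mixedDeriv l m (M.subLogLik sub η x) t θ

/-- The density `p_{t, η_t(θ, η)}(x)`, as a function of `(t, θ)`. -/
def subDensity (M : SemiparametricModel 𝒳 E) (sub : ℝ → ℝ → E → E) (η : E) (x : 𝒳) (t θ : ℝ) : ℝ :=
  M.p t (sub t θ η) x

/-- The neighbourhoods of `(θ₀, θ₀, η₀)` in `Θ × Θ × H`. -/
def nbhd (M : SemiparametricModel 𝒳 E) (θ₀ : ℝ) (η₀ : E) (ε : ℝ) : Set (ℝ × ℝ × E) :=
  {v | v.1 ∈ M.Θ ∧ |v.1 - θ₀| < ε ∧ v.2.1 ∈ M.Θ ∧ |v.2.1 - θ₀| < ε ∧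
    v.2.2 ∈ M.H ∧ ‖v.2.2 - η₀‖ < ε}

/-- The orders `(l, m)` of differentiation in `(t, θ)`. -/
def orders : Set (ℕ × ℕ) := {(0, 0), (1, 0), (2, 0), (3, 0), (1, 1), (1, 2), (2, 1)}

/-- The class of functions `∂^{l+m} ℓ(t, θ, η) / ∂t^l ∂θ^m` with `(t, θ, η) ∈ V`. -/
def ellClass (M : SemiparametricModel 𝒳 E) (sub : ℝ → ℝ → E → E) (l m : ℕ)
    (V : Set (ℝ × ℝ × E)) : Set (𝒳 → ℝ) :=
  (fun v => M.ell sub l m v.1 v.2.1 v.2.2) '' V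

/-- The standing assumptions. `(θ₀, η₀)` is the true parameter, `D` the collection of paths that
define the nuisance scores, `sub t θ η = η_t(θ, η)` the least favorable submodel, and
`ηhat n x θ` the maximiser of `η ↦ lik_n(θ, η)`. -/
structure StandingAssumptions (M : SemiparametricModel 𝒳 E) (θ₀ : ℝ) (η₀ : E) (D : Set (ℝ → E))
    (sub : ℝ → ℝ → E → E) (ηhat : (n : ℕ) → (Fin n → 𝒳) → ℝ → E) : Prop where
  /-- the parameter sets -/
  isCompact_Θ : IsCompact M.Θ
  mem_interior : θ₀ ∈ interior M.Θ
  mem_H : η₀ ∈ M.H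
  /-- the ordinary score exists and is square-integrable -/
  score_diff : ∀ᵐ x ∂M.P θ₀ η₀, DifferentiableAt ℝ (fun θ => M.logLik θ η₀ x) θ₀
  score_memLp : MemLp (M.score θ₀ η₀) 2 (M.P θ₀ η₀)
  /-- the nuisance scores -/
  paths : ∀ γ ∈ D, M.IsNuisancePath θ₀ η₀ γ
  /-- `η_t(θ, η)` is a nuisance parameter for `(t, θ, η)` near `(θ₀, θ₀, η₀)` -/
  sub_mem : ∃ ε > 0, ∀ v ∈ M.nbhd θ₀ η₀ ε, sub v.1 v.2.1 v.2.2 ∈ M.H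
  /-- the submodel is least favorable at `(θ₀, η₀)` -/
  least_favorable : M.ell sub 1 0 θ₀ θ₀ η₀ =ᵐ[M.P θ₀ η₀] M.efficientScore θ₀ η₀ D
  /-- the submodel passes through `(θ, η)` -/
  sub_diag : ∀ θ ∈ M.Θ, ∀ η ∈ M.H, sub θ θ η = η
  /-- the profile maximiser, and its parametric rate of convergence -/
  ηhat_max : ∀ᶠ n in atTop, ∀ᵐ x ∂sampleLaw (M.P θ₀ η₀) n, ∀ θ ∈ M.Θ,
    ηhat n x θ ∈ M.H ∧ ∀ η ∈ M.H, M.lik n x θ η ≤ M.lik n x θ (ηhat n x θ)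
  rate : ∀ θt : (n : ℕ) → (Fin n → 𝒳) → ℝ, (∀ n x, θt n x ∈ M.Θ) →
    IsLittleOP (M.P θ₀ η₀) (fun n x => ENNReal.ofReal |θt n x - θ₀|) →
    IsBigOP (M.P θ₀ η₀) (fun n x => ENNReal.ofReal ‖ηhat n x (θt n x) - η₀‖)
      fun n x => (√(n : ℝ))⁻¹ + |θt n x - θ₀|
  /-- the log-likelihood is finite near `(θ₀, θ₀, η₀)`, its derivatives exist there and have
  integrable envelopes -/
  envelope : ∃ ε > 0, ∃ F : 𝒳 → ℝ, Integrable F (M.P θ₀ η₀) ∧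
    ∀ᵐ x ∂M.P θ₀ η₀, ∀ v ∈ M.nbhd θ₀ η₀ ε, 0 < M.p v.1 (sub v.1 v.2.1 v.2.2) x ∧
      ∀ o ∈ orders, MixedDiffAt (M.subLogLik sub v.2.2 x) v.1 v.2.1 o.1 o.2 ∧
        |M.ell sub o.1 o.2 v.1 v.2.1 v.2.2 x| ≤ F x
  /-- the identity `∫ p_{t, η_t(θ, η₀)} dμ = 1` may be differentiated under the integral sign near
  `(θ₀, θ₀)`: these densities vanish where the true one does, and the derivatives involved exist and
  have an integrable envelope -/
  density_envelope : ∃ ε > 0, ∃ G : 𝒳 → ℝ, Integrable G M.μ ∧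
    ∀ᵐ x ∂M.μ, ∀ t θ : ℝ, |t - θ₀| < ε → |θ - θ₀| < ε →
      (M.p θ₀ η₀ x = 0 → M.p t (sub t θ η₀) x = 0) ∧
      ∀ o ∈ ({(1, 0), (2, 0), (1, 1)} : Set (ℕ × ℕ)),
        MixedDiffAt (M.subDensity sub η₀ x) t θ o.1 o.2 ∧
          |mixedDeriv o.1 o.2 (M.subDensity sub η₀ x) t θ| ≤ G x
  /-- the Donsker and Glivenko–Cantelli conditions -/
  classes : ∃ ε > 0,
    IsDonsker (M.P θ₀ η₀) (M.ellClass sub 2 0 (M.nbhd θ₀ η₀ ε)) ∧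
    IsDonsker (M.P θ₀ η₀) (M.ellClass sub 1 1 (M.nbhd θ₀ η₀ ε)) ∧
    IsGlivenkoCantelli (M.P θ₀ η₀) (M.ellClass sub 3 0 (M.nbhd θ₀ η₀ ε))
  /-- `𝔾_n(ℓ'(θ₀, θ₀, η) - ℓ'₀) = O_P(‖η - η₀‖)`, uniformly in `η` near `η₀` -/
  modulus : ∃ ε > 0, ∀ δ : ℝ, 0 < δ → ∃ C : ℝ, 0 < C ∧ ∀ᶠ n in atTop,
    sampleLaw (M.P θ₀ η₀) n {x | ∃ η ∈ M.H, ‖η - η₀‖ < ε ∧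
      C * ‖η - η₀‖ < |empGn (M.P θ₀ η₀) n x fun y =>
        M.ell sub 1 0 θ₀ θ₀ η y - M.ell sub 1 0 θ₀ θ₀ η₀ y|} ≤ ENNReal.ofReal δ
  /-- the smoothness conditions in the nuisance parameter -/
  smooth_tt : ∃ ε > 0, ∃ C : ℝ, ∀ η ∈ M.H, ‖η - η₀‖ < ε →
    |(∫ x, M.ell sub 2 0 θ₀ θ₀ η x ∂M.P θ₀ η₀) - ∫ x, M.ell sub 2 0 θ₀ θ₀ η₀ x ∂M.P θ₀ η₀| ≤
      C * ‖η - η₀‖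
  smooth_tθ : ∃ ε > 0, ∃ C : ℝ, ∀ η ∈ M.H, ‖η - η₀‖ < ε →
    |(∫ x, M.ell sub 1 1 θ₀ θ₀ η x ∂M.P θ₀ η₀) - ∫ x, M.ell sub 1 1 θ₀ θ₀ η₀ x ∂M.P θ₀ η₀| ≤
      C * ‖η - η₀‖
  no_bias : ∃ ε > 0, ∃ C : ℝ, ∀ η ∈ M.H, ‖η - η₀‖ < ε →
    |∫ x, M.ell sub 1 0 θ₀ θ₀ η x ∂M.P θ₀ η₀| ≤ C * ‖η - η₀‖ ^ 2
  /-- the efficient information is positive -/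
  info_pos : 0 < M.efficientInfo θ₀ η₀ D

end SemiparametricModel

end

/-! Put `a(t, θ) = ℙ_n ℓ(t, θ, η̂_θ)`. The point `η_t(θ, η̂_θ)` is one competitor in the supremum
defining `pl_n(t)`, and it is `η̂_t` when `θ = t`; so, near `θ₀`, `a(t, θ) ≤ a(t, t) = n⁻¹ log
pl_n(t)`. The profile is an upper envelope of smooth one-dimensional submodels, and only these are
ever differentiated.

Their scores satisfy `∂_t a(t, θ) = W - Ĩ₀ (t - θ₀) + O_P((n^{-1/2} + |θ - θ₀| + |t - θ₀|)²)` with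
`W = ℙ_n ℓ̃₀` (`exists_score_expansion`). There is no term linear in `θ - θ₀` because `P ℓ_{t,θ} =
0` at the truth, which is the orthogonality of the efficient score to the nuisance scores
(`integral_ell`); there is no first-order effect of `η̂_θ - η₀` by the no-bias and modulus
conditions.

The score vanishes at `t = θ = θ̂`, whence `θ̂ - θ₀ = O_P(n^{-1/2})`. Integrating the scores from
`θ̂` to `θ`, once with second argument `θ` and once with `θ̂`, sandwiches `n⁻¹ log (pl_n(θ) /
pl_n(θ̂))` around `-(Ĩ₀/2)(θ - θ̂)²` up to `O((n^{-1/2} + |θ - θ̂|)³)` on a fixed neighbourhood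
(`abs_profile_expansion_le`).

In the scale `y = √n (θ - θ̂)` the error in the exponent is of order `n^{-1/2} (1 + |y|)³`, and on a
small neighbourhood part of the Gaussian exponent absorbs it. Away from `θ₀` identifiability makes
the likelihood ratio exponentially small (`exists_identifiability_gap`). Hence the unnormalised
posterior is within `O(1/n)` in `L¹` of a Gaussian of mass of order `n^{-1/2}`
(`exists_integral_abs_sub_gaussian_le`), and normalising gives the rate for all `ξ` at once.

The rate and identifiability hypotheses speak of random sequences, whereas the argument needs
uniformity in `θ`; `exists_exceptional_sequence` turns one into the other by contradiction. -/

section HighProbability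

variable {𝒳 : Type*} [MeasurableSpace 𝒳]

/-! ### Events of high outer probability, and uniformity from random sequences. -/

instance instIsProbabilityMeasureSampleLaw (P : Measure 𝒳) [IsProbabilityMeasure P] (n : ℕ) :
    IsProbabilityMeasure (sampleLaw P n) := by
  unfold sampleLaw; infer_instance

/-- For large `n`, the property `p n` of the sample fails with outer probability at most `ε`. -/
def HoldsUpTo (P : Measure 𝒳) (ε : ℝ) (p : (n : ℕ) → (Fin n → 𝒳) → Prop) : Prop :=
  ∀ᶠ n in atTop, sampleLaw P n {x | ¬ p n x} ≤ ENNReal.ofReal ε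

namespace HoldsUpTo

variable {P : Measure 𝒳} {ε ε₁ ε₂ : ℝ} {p q : (n : ℕ) → (Fin n → 𝒳) → Prop}

theorem and (h₁ : 0 ≤ ε₁) (h₂ : 0 ≤ ε₂) (hp : HoldsUpTo P ε₁ p) (hq : HoldsUpTo P ε₂ q) :
    HoldsUpTo P (ε₁ + ε₂) fun n x => p n x ∧ q n x := by
  filter_upwards [hp, hq] with n hn hn'
  rw [ENNReal.ofReal_add h₁ h₂]
  refine le_trans (measure_mono ?_) ((measure_union_le _ _).trans (add_le_add hn hn'))
  intro x hx
  simp only [mem_ofPred_eq, mem_union] at hx ⊢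
  tauto

theorem mono (hp : HoldsUpTo P ε p) (h : ∀ᶠ n in atTop, ∀ x, p n x → q n x) :
    HoldsUpTo P ε q := by
  filter_upwards [hp, h] with n hn hn'
  exact (measure_mono (ofPred_subset_ofPred.2 fun x hx hpx => hx (hn' x hpx))).trans hn

theorem and_ae (hp : HoldsUpTo P ε p) (h : ∀ᶠ n in atTop, ∀ᵐ x ∂sampleLaw P n, q n x) :
    HoldsUpTo P ε fun n x => p n x ∧ q n x := by
  filter_upwards [hp, h] with n hn hn'
  refine le_trans (measure_mono_ae ?_) hn
  filter_upwards [hn'] with x hx hx'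
  exact fun hp => hx' ⟨hp, hx⟩

end HoldsUpTo

theorem ae_sampleLaw_forall {P : Measure 𝒳} [IsProbabilityMeasure P] {p : 𝒳 → Prop}
    (h : ∀ᵐ y ∂P, p y) (n : ℕ) : ∀ᵐ x ∂sampleLaw P n, ∀ i, p (x i) := by
  rw [ae_all_iff]
  intro i
  exact (measurePreserving_eval (fun _ : Fin n => P) i).quasiMeasurePreserving.ae h

/-- Only stochastic boundedness of `sup_F |𝔾_n f|` is extracted from the Donsker property. A
continuous cutoff of the norm at level `k` has small mean under the limit law for large `k`, its
outer expectations converge to that mean, and Markov's inequality for a measurable majorant bounds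
the outer probability. -/
theorem IsDonsker.exists_bound {P : Measure 𝒳} [IsProbabilityMeasure P] {F : Set (𝒳 → ℝ)}
    (hF : IsDonsker P F) {ε : ℝ} (hε : 0 < ε) :
    ∃ K : ℝ, 0 < K ∧ HoldsUpTo P ε fun n x => ∀ f ∈ F, |empGn P n x f| ≤ K := by
  obtain ⟨-, hbdd, L, hL, -, hconv⟩ := hF
  let g : ℕ → LInfty F → ℝ := fun k z => min 1 (max 0 (‖z‖ - k))
  have hg0 : ∀ k z, 0 ≤ g k z := fun k z => le_min zero_le_one (le_max_left _ _)
  have hg1 : ∀ k z, g k z ≤ 1 := fun k z => min_le_left _ _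
  have hgc : ∀ k, Continuous (g k) := fun k => by fun_prop
  let G : ℕ → BoundedContinuousFunction (LInfty F) ℝ := fun k =>
    BoundedContinuousFunction.ofNormedAddCommGroup (g k) (hgc k) 1 fun z => by
      rw [Real.norm_eq_abs, abs_of_nonneg (hg0 k z)]; exact hg1 k z
  have hlim : Tendsto (fun k => ∫ z, G k z ∂L) atTop (𝓝 (∫ z, (0 : ℝ) ∂L)) := by
    refine tendsto_integral_of_dominated_convergence (fun _ => (1 : ℝ))
      (fun k => (hgc k).aestronglyMeasurable) (integrable_const _) ?_ ?_
    · intro k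
      refine ae_of_all _ fun z => ?_
      change ‖g k z‖ ≤ 1
      rw [Real.norm_eq_abs, abs_of_nonneg (hg0 k z)]; exact hg1 k z
    · refine ae_of_all _ fun z => ?_
      refine tendsto_const_nhds.congr' ?_
      filter_upwards [eventually_ge_atTop ⌈‖z‖⌉₊] with k hk
      have : ‖z‖ ≤ k := (Nat.le_ceil _).trans (by exact_mod_cast hk)
      change 0 = g k z
      simp only [g]
      rw [max_eq_left (by linarith)]; simp
  rw [integral_zero] at hlim
  obtain ⟨k, hk⟩ := ((tendsto_order.1 hlim).2 ε hε).exists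
  refine ⟨k + 1, by positivity, ?_⟩
  filter_upwards [(tendsto_order.1 (hconv (G k))).2 ε hk] with n hn
  -- `outerExp` is an `sInf`, so a near-optimal majorant exists only if the set is nonempty; the
  -- constant `1` is in it.
  have hne : {r | ∃ U : (Fin n → 𝒳) → ℝ, Measurable U ∧ Integrable U (sampleLaw P n) ∧
      (∀ ω, G k (toLInfty fun f : F => empGn P n ω f) ≤ U ω) ∧
      r = ∫ ω, U ω ∂sampleLaw P n}.Nonempty :=
    ⟨_, fun _ => 1, measurable_const, integrable_const _, fun ω => hg1 k _, rfl⟩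
  obtain ⟨_, ⟨U, hUm, hUi, hU, rfl⟩, hlt⟩ := exists_lt_of_csInf_lt hne hn
  have hU0 : ∀ ω, 0 ≤ U ω := fun ω => (hg0 k _).trans (hU ω)
  have hmark := mul_meas_ge_le_integral_of_nonneg (ae_of_all _ hU0) hUi 1
  rw [one_mul] at hmark
  have hsub : sampleLaw P n {x | ¬ ∀ f ∈ F, |empGn P n x f| ≤ (k : ℝ) + 1} ≤
      sampleLaw P n {x | 1 ≤ U x} := by
    refine measure_mono_ae ?_
    filter_upwards [ae_sampleLaw_forall hbdd n] with x hx hx'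
    change ¬ ∀ f ∈ F, |empGn P n x f| ≤ (k : ℝ) + 1 at hx'
    push Not at hx'
    obtain ⟨f, hf, hfk⟩ := hx'
    change 1 ≤ U x
    -- Almost sure boundedness of the paths rules out the value `0` that `toLInfty` gives to
    -- unbounded functions.
    have hmem : Memℓp (fun f : F => empGn P n x f) ∞ := by
      choose b hb using hx
      refine memℓp_infty ⟨(√(n : ℝ))⁻¹ * ∑ i, b i, ?_⟩
      rintro _ ⟨f, rfl⟩
      simp only [empGn, Real.norm_eq_abs, abs_mul]
      rw [abs_of_nonneg (by positivity : (0 : ℝ) ≤ (√(n : ℝ))⁻¹)]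
      refine mul_le_mul_of_nonneg_left ?_ (by positivity)
      refine (Finset.abs_sum_le_sum_abs _ _).trans (Finset.sum_le_sum fun i _ => ?_)
      exact hb i ⟨f, rfl⟩
    refine le_trans ?_ (hU x)
    change 1 ≤ g k _
    have hnorm : (k : ℝ) + 1 ≤ ‖toLInfty fun f : F => empGn P n x f‖ := by
      refine hfk.le.trans ?_
      have := lp.norm_apply_le_norm (ENNReal.top_ne_zero) (toLInfty fun f : F => empGn P n x f)
        ⟨f, hf⟩
      rw [toLInfty, dif_pos hmem] at this ⊢
      exact this
    simp only [g]
    rw [max_eq_right (by linarith)]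
    exact le_min le_rfl (by linarith)
  refine hsub.trans ?_
  rw [← ENNReal.ofReal_toReal (measure_ne_top (sampleLaw P n) {x | 1 ≤ U x})]
  exact ENNReal.ofReal_le_ofReal (hmark.trans hlt.le)

theorem integrable_eval_sampleLaw {P : Measure 𝒳} [IsProbabilityMeasure P] {F : 𝒳 → ℝ}
    (hF : Integrable F P) {n : ℕ} (i : Fin n) : Integrable (fun x => F (x i)) (sampleLaw P n) :=
  (measurePreserving_eval (fun _ : Fin n => P) i).integrable_comp_of_integrable hF

theorem integral_eval_sampleLaw {P : Measure 𝒳} [IsProbabilityMeasure P] {F : 𝒳 → ℝ}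
    (hF : AEStronglyMeasurable F P) {n : ℕ} (i : Fin n) :
    ∫ x, F (x i) ∂sampleLaw P n = ∫ y, F y ∂P := by
  have h := measurePreserving_eval (fun _ : Fin n => P) i
  have := integral_map (μ := sampleLaw P n) h.measurable.aemeasurable (f := F)
    (by rw [sampleLaw, h.map_eq]; exact hF)
  rw [sampleLaw, h.map_eq] at this
  exact this.symm

/-- Markov's inequality; the `+ 1` in `K` keeps it positive when `F` has mean zero. -/
theorem exists_empMean_le {P : Measure 𝒳} [IsProbabilityMeasure P] {F : 𝒳 → ℝ}
    (hF : Integrable F P) (hF0 : 0 ≤ᵐ[P] F) {ε : ℝ} (hε : 0 < ε) :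
    ∃ K : ℝ, 0 < K ∧ HoldsUpTo P ε fun n x => empMean n x F ≤ K := by
  have hI : 0 ≤ ∫ y, F y ∂P := integral_nonneg_of_ae hF0
  set K := ((∫ y, F y ∂P) + 1) / ε with hK
  have hKpos : 0 < K := by positivity
  refine ⟨K, hKpos, ?_⟩
  filter_upwards [eventually_ge_atTop 1] with n hn
  have hn' : (n : ℝ) ≠ 0 := by positivity
  have hint : Integrable (fun x => empMean n x F) (sampleLaw P n) :=
    (integrable_finsetSum _ fun i _ => integrable_eval_sampleLaw hF i).const_mul _
  have hval : ∫ x, empMean n x F ∂sampleLaw P n = ∫ y, F y ∂P := by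
    simp only [empMean]
    rw [integral_const_mul, integral_finsetSum _ fun i _ => integrable_eval_sampleLaw hF i]
    simp only [integral_eval_sampleLaw hF.1, Finset.sum_const, Finset.card_univ, Fintype.card_fin,
      nsmul_eq_mul]
    field_simp
  have h0 : 0 ≤ᵐ[sampleLaw P n] fun x => empMean n x F := by
    filter_upwards [ae_sampleLaw_forall hF0 n] with x hx
    exact mul_nonneg (by positivity) (Finset.sum_nonneg fun i _ => hx i)
  have hm := mul_meas_ge_le_integral_of_nonneg h0 hint K
  rw [hval] at hm
  have h2 : (sampleLaw P n).real {x | K ≤ empMean n x F} ≤ ε := by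
    have h3 : K * (sampleLaw P n).real {x | K ≤ empMean n x F} ≤ K * ε := by
      refine hm.trans ?_
      rw [hK, div_mul_cancel₀ _ hε.ne']; linarith
    exact le_of_mul_le_mul_left h3 hKpos
  calc sampleLaw P n {x | ¬ empMean n x F ≤ K}
      ≤ sampleLaw P n {x | K ≤ empMean n x F} :=
        measure_mono fun x hx => (not_le.1 hx).le
    _ = ENNReal.ofReal ((sampleLaw P n).real {x | K ≤ empMean n x F}) :=
        (ENNReal.ofReal_toReal (measure_ne_top _ _)).symm
    _ ≤ ENNReal.ofReal ε := ENNReal.ofReal_le_ofReal h2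

/-- Chebyshev's inequality, the variance of the sum being `n` times that of `f`. -/
theorem exists_abs_empMean_le {P : Measure 𝒳} [IsProbabilityMeasure P] {f : 𝒳 → ℝ}
    (hf : MemLp f 2 P) (hf0 : ∫ y, f y ∂P = 0) {ε : ℝ} (hε : 0 < ε) :
    ∃ K : ℝ, 0 < K ∧ HoldsUpTo P ε fun n x => |empMean n x f| ≤ K * (√(n : ℝ))⁻¹ := by
  have hV : 0 ≤ variance f P := variance_nonneg _ _
  set K := √((variance f P + 1) / ε) with hK
  have hKpos : 0 < K := Real.sqrt_pos.2 (by positivity)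
  refine ⟨K, hKpos, ?_⟩
  filter_upwards [eventually_ge_atTop 1] with n hn
  have hn0 : (0 : ℝ) < n := by exact_mod_cast hn
  have hs : 0 < √(n : ℝ) := Real.sqrt_pos.2 hn0
  have hmp := fun i => measurePreserving_eval (fun _ : Fin n => P) i
  have hLp : ∀ i : Fin n, MemLp (fun x : Fin n → 𝒳 => f (x i)) 2 (sampleLaw P n) := fun i =>
    hf.comp_measurePreserving (hmp i)
  let S : (Fin n → 𝒳) → ℝ := fun x => ∑ i, f (x i)
  have hS : S = ∑ i : Fin n, fun x : Fin n → 𝒳 => f (x i) := by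
    ext x; simp [S]
  have hSLp : MemLp S 2 (sampleLaw P n) := by
    rw [hS]; exact memLp_finsetSum' _ fun i _ => hLp i
  have hmean : ∫ x, S x ∂sampleLaw P n = 0 := by
    simp only [S]
    rw [integral_finsetSum _ fun i _ => integrable_eval_sampleLaw (hf.integrable (by norm_num)) i]
    simp [integral_eval_sampleLaw hf.1, hf0]
  have hvar : variance S (sampleLaw P n) = n * variance f P := by
    have hv := variance_sum_pi (μ := fun _ : Fin n => P) (X := fun _ => f) (fun _ => hf)
    rw [hS]
    rw [sampleLaw, hv]
    simp
  have hc : 0 < K * √(n : ℝ) := by positivity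
  have hch := meas_ge_le_variance_div_sq hSLp hc
  rw [hmean, hvar] at hch
  refine le_trans (measure_mono ?_) (hch.trans (ENNReal.ofReal_le_ofReal ?_))
  · intro x hx
    simp only [mem_ofPred_eq, not_le, sub_zero] at hx ⊢
    have : |empMean n x f| = (n : ℝ)⁻¹ * |S x| := by
      simp only [empMean, abs_mul, S]
      rw [abs_of_nonneg (by positivity : (0 : ℝ) ≤ (n : ℝ)⁻¹)]
    rw [this] at hx
    have h2 : (√(n : ℝ))⁻¹ = (n : ℝ)⁻¹ * √(n : ℝ) := by
      field_simp
      rw [Real.sq_sqrt hn0.le]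
    rw [h2, mul_left_comm] at hx
    exact (lt_of_mul_lt_mul_left hx (by positivity)).le
  · rw [mul_pow, Real.sq_sqrt hn0.le, hK, Real.sq_sqrt (by positivity), mul_comm,
      mul_div_mul_right _ _ hn0.ne', div_le_iff₀ (by positivity), mul_div_cancel₀ _ hε.ne']
    linarith

/-- If with non-vanishing outer probability there are exceptional parameters, of all orders `k`,
then a single random sequence picks them up along a subsequence of sample sizes. -/
theorem exists_exceptional_sequence (P : Measure 𝒳) {Θ : Set ℝ} {ε : ℝ}
    (B : ℕ → (n : ℕ) → (Fin n → 𝒳) → ℝ → Prop)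
    (hB : ∀ k, ∃ᶠ n in atTop, ENNReal.ofReal ε < sampleLaw P n {x | ∃ θ ∈ Θ, B k n x θ})
    (d : (n : ℕ) → (Fin n → 𝒳) → ℝ) (hd : ∀ n x, d n x ∈ Θ) :
    ∃ (φ : ℕ → ℕ) (θt : (n : ℕ) → (Fin n → 𝒳) → ℝ), StrictMono φ ∧ (∀ n x, θt n x ∈ Θ) ∧
      (∀ n x, θt n x = d n x ∨ ∃ k, n = φ k ∧ B k n x (θt n x)) ∧
      ∀ k, ENNReal.ofReal ε < sampleLaw P (φ k) {x | B k (φ k) x (θt (φ k) x)} := by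
  classical
  -- One sample size `φ k` per order `k`. Since all probabilities are outer, the exceptional
  -- parameter can be picked by choice, with no measurable selection.
  obtain ⟨φ, hφ, hφB⟩ := extraction_forall_of_frequently hB
  let θt : (n : ℕ) → (Fin n → 𝒳) → ℝ := fun n x =>
    if h : ∃ θ, θ ∈ Θ ∧ ∃ k, n = φ k ∧ B k n x θ then h.choose else d n x
  have hpos : ∀ n x, (∃ θ, θ ∈ Θ ∧ ∃ k, n = φ k ∧ B k n x θ) →
      θt n x ∈ Θ ∧ ∃ k, n = φ k ∧ B k n x (θt n x) := by
    intro n x h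
    simp only [θt, dif_pos h]
    exact h.choose_spec
  have hneg : ∀ n x, ¬ (∃ θ, θ ∈ Θ ∧ ∃ k, n = φ k ∧ B k n x θ) → θt n x = d n x := by
    intro n x h
    simp only [θt, dif_neg h]
  refine ⟨φ, θt, hφ, fun n x => ?_, fun n x => ?_, fun k => (hφB k).trans_le (measure_mono ?_)⟩
  · by_cases h : ∃ θ, θ ∈ Θ ∧ ∃ k, n = φ k ∧ B k n x θ
    · exact (hpos n x h).1
    · rw [hneg n x h]; exact hd n x
  · by_cases h : ∃ θ, θ ∈ Θ ∧ ∃ k, n = φ k ∧ B k n x θ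
    · exact Or.inr (hpos n x h).2
    · exact Or.inl (hneg n x h)
  · rintro x ⟨θ, hθ, hBθ⟩
    obtain ⟨-, k', hk', hB'⟩ := hpos (φ k) x ⟨θ, hθ, k, rfl, hBθ⟩
    -- Injectivity of `φ` identifies the order attached to the chosen parameter with the given `k`.
    rw [← hφ.injective hk'] at hB'
    exact hB'

/-- If no pair `(K, δ)` works, the pairs `(k + 1, 1 / (k + 1))` all fail with outer probability
above `ε` for infinitely many `n`. A sequence collecting these failures, and equal to `θ₀`
otherwise, is consistent but violates the rate along a subsequence. -/
theorem exists_uniform_rate {P : Measure 𝒳} {E : Type*} [NormedAddCommGroup E] {Θ : Set ℝ}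
    {θ₀ : ℝ} (hθ₀ : θ₀ ∈ Θ) {η₀ : E} {ηhat : (n : ℕ) → (Fin n → 𝒳) → ℝ → E}
    (rate : ∀ θt : (n : ℕ) → (Fin n → 𝒳) → ℝ, (∀ n x, θt n x ∈ Θ) →
      IsLittleOP P (fun n x => ENNReal.ofReal |θt n x - θ₀|) →
      IsBigOP P (fun n x => ENNReal.ofReal ‖ηhat n x (θt n x) - η₀‖)
        fun n x => (√(n : ℝ))⁻¹ + |θt n x - θ₀|) {ε : ℝ} (hε : 0 < ε) :
    ∃ K δ : ℝ, 0 < K ∧ 0 < δ ∧ HoldsUpTo P ε fun n x => ∀ θ ∈ Θ, |θ - θ₀| < δ →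
      ‖ηhat n x θ - η₀‖ ≤ K * ((√(n : ℝ))⁻¹ + |θ - θ₀|) := by
  by_contra hcon
  push Not at hcon
  let B : ℕ → (n : ℕ) → (Fin n → 𝒳) → ℝ → Prop := fun k n x θ =>
    |θ - θ₀| < 1 / ((k : ℝ) + 1) ∧
      ((k : ℝ) + 1) * ((√(n : ℝ))⁻¹ + |θ - θ₀|) < ‖ηhat n x θ - η₀‖
  have hB : ∀ k, ∃ᶠ n in atTop, ENNReal.ofReal ε < sampleLaw P n {x | ∃ θ ∈ Θ, B k n x θ} := by
    intro k
    have h := hcon ((k : ℝ) + 1) (1 / ((k : ℝ) + 1)) (by positivity) (by positivity)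
    rw [HoldsUpTo, not_eventually] at h
    refine h.mono fun n hn => ?_
    rw [not_le] at hn
    refine hn.trans_le (measure_mono fun x hx => ?_)
    simp only [mem_ofPred_eq] at hx ⊢
    push Not at hx
    exact hx
  obtain ⟨φ, θt, hφ, hmem, hor, hbig⟩ :=
    exists_exceptional_sequence P B hB (fun _ _ => θ₀) fun _ _ => hθ₀
  have hlit : IsLittleOP P (fun n x => ENNReal.ofReal |θt n x - θ₀|) := by
    intro ε' hε'
    obtain ⟨k₀, hk₀⟩ := exists_nat_one_div_lt hε'
    refine tendsto_const_nhds.congr' ?_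
    filter_upwards [eventually_ge_atTop (φ k₀)] with n hn
    symm
    convert measure_empty (μ := sampleLaw P n)
    rw [eq_empty_iff_forall_notMem]
    intro x hx
    simp only [mem_ofPred_eq] at hx
    have hx' := lt_of_not_ge fun h => hx.not_ge (ENNReal.ofReal_le_ofReal h)
    rcases hor n x with h | ⟨k, rfl, h, -⟩
    · rw [h] at hx'; simp at hx'; linarith
    · have hk : k₀ ≤ k := hφ.le_iff_le.1 hn
      have : 1 / ((k : ℝ) + 1) ≤ 1 / ((k₀ : ℝ) + 1) := by
        apply one_div_le_one_div_of_le (by positivity)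
        have : (k₀ : ℝ) ≤ k := by exact_mod_cast hk
        linarith
      linarith
  obtain ⟨M, hM, hev⟩ := rate θt hmem hlit ε hε
  obtain ⟨k, hk1, hk2⟩ := ((hφ.tendsto_atTop.eventually hev).and
    (eventually_ge_atTop ⌈M⌉₊)).exists
  have hMk : M ≤ k := (Nat.le_ceil _).trans (by exact_mod_cast hk2)
  refine absurd (hbig k) (not_lt.2 (le_trans (measure_mono fun x hx => ?_) hk1))
  obtain ⟨-, hx⟩ := hx
  have hr : 0 ≤ (√(φ k : ℝ))⁻¹ + |θt (φ k) x - θ₀| := by positivity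
  have h1 : M * ((√(φ k : ℝ))⁻¹ + |θt (φ k) x - θ₀|) < ‖ηhat (φ k) x (θt (φ k) x) - η₀‖ :=
    lt_of_le_of_lt (mul_le_mul_of_nonneg_right (by linarith) hr) hx
  exact (ENNReal.ofReal_lt_ofReal_iff (lt_of_le_of_lt (by positivity) h1)).2 h1

end HighProbability

/-! ### Mean value and Taylor bounds; measurability of derivatives. -/

section Calculus

theorem abs_sub_le_of_hasDerivAt {f f' : ℝ → ℝ} {a ε K : ℝ}
    (hf : ∀ t, |t - a| < ε → HasDerivAt f (f' t) t) (hK : ∀ t, |t - a| < ε → |f' t| ≤ K)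
    {s t : ℝ} (hs : |s - a| < ε) (ht : |t - a| < ε) : |f t - f s| ≤ K * |t - s| := by
  have := (convex_ball a ε).norm_image_sub_le_of_norm_hasDerivWithin_le (f := f) (f' := f')
    (C := K) (x := s) (y := t)
    (fun x hx => (hf x (by rwa [Metric.mem_ball, Real.dist_eq] at hx)).hasDerivWithinAt)
    (fun x hx => hK x (by rwa [Metric.mem_ball, Real.dist_eq] at hx))
    (by rwa [Metric.mem_ball, Real.dist_eq]) (by rwa [Metric.mem_ball, Real.dist_eq])
  exact this

theorem abs_sub_sub_le_of_hasDerivAt {f f' f'' : ℝ → ℝ} {a ε K : ℝ}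
    (hf : ∀ t, |t - a| < ε → HasDerivAt f (f' t) t)
    (hf' : ∀ t, |t - a| < ε → HasDerivAt f' (f'' t) t)
    (hK : ∀ t, |t - a| < ε → |f'' t| ≤ K) {t : ℝ} (ht : |t - a| < ε) :
    |f t - f a - (t - a) * f' a| ≤ K * (t - a) ^ 2 := by
  have hε : 0 < ε := (abs_nonneg _).trans_lt ht
  have ha : |a - a| < ε := by simpa using hε
  have hK0 : 0 ≤ K := (abs_nonneg _).trans (hK a ha)
  have key := (convex_uIcc a t).norm_image_sub_le_of_norm_hasDerivWithin_le
    (f := fun s => f s - (s - a) * f' a) (f' := fun s => f' s - f' a)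
    (C := K * |t - a|) (x := a) (y := t) (fun s hs => ?_) (fun s hs => ?_) left_mem_uIcc
    right_mem_uIcc
  · simp only [sub_self, zero_mul, sub_zero, Real.norm_eq_abs] at key
    calc |f t - f a - (t - a) * f' a| = |f t - (t - a) * f' a - f a| := by ring_nf
      _ ≤ K * |t - a| * |t - a| := key
      _ = K * (t - a) ^ 2 := by rw [mul_assoc, abs_mul_abs_self]; ring
  · have hs' : |s - a| < ε := (abs_sub_left_of_mem_uIcc hs).trans_lt ht
    have h2 : HasDerivAt (fun s => (s - a) * f' a) (1 * f' a) s :=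
      ((hasDerivAt_id s).sub_const a).mul_const _
    rw [one_mul] at h2
    exact ((hf s hs').sub h2).hasDerivWithinAt
  · have hs1 : |s - a| ≤ |t - a| := abs_sub_left_of_mem_uIcc hs
    have hs' : |s - a| < ε := hs1.trans_lt ht
    exact (abs_sub_le_of_hasDerivAt hf' hK ha hs').trans (mul_le_mul_of_nonneg_left hs1 hK0)

/-- Serves to differentiate along the diagonal `t = θ`, where joint differentiability is not
assumed. -/
theorem hasDerivAt_of_abs_sub_le_sq {f : ℝ → ℝ} {a c ε K : ℝ} (hε : 0 < ε)
    (h : ∀ t, |t - a| < ε → |f t - f a - (t - a) * c| ≤ K * (t - a) ^ 2) :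
    HasDerivAt f c a := by
  rw [hasDerivAt_iff_isLittleO]
  have h1 : (fun t => f t - f a - (t - a) • c) =O[𝓝 a] fun t => (t - a) ^ 2 := by
    refine Asymptotics.IsBigO.of_bound K ?_
    filter_upwards [Metric.ball_mem_nhds a hε] with t ht
    rw [Metric.mem_ball, Real.dist_eq] at ht
    simpa using h t ht
  refine h1.trans_isLittleO ?_
  have h2 : (fun t : ℝ => t ^ 2) =o[𝓝 0] fun t => t := by
    simpa using Asymptotics.isLittleO_pow_pow (𝕜 := ℝ) (m := 1) (n := 2) (by norm_num)
  have h3 : Tendsto (fun t : ℝ => t - a) (𝓝 a) (𝓝 0) := by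
    have : Tendsto (fun t : ℝ => t - a) (𝓝 a) (𝓝 (a - a)) := by
      exact (continuous_id.sub continuous_const).tendsto a
    simpa using this
  exact h2.comp_tendsto h3

/-- A derivative is the limit of difference quotients along one sequence; this supplies the
measurability of scores and density derivatives, which is nowhere assumed directly. -/
theorem aestronglyMeasurable_of_hasDerivAt {X : Type*} [MeasurableSpace X] {μ : Measure X}
    {F : ℝ → X → ℝ} {F' : X → ℝ} {a : ℝ} (hF : ∀ᶠ t in 𝓝 a, AEStronglyMeasurable (F t) μ)
    (h : ∀ᵐ x ∂μ, HasDerivAt (fun t => F t x) (F' x) a) : AEStronglyMeasurable F' μ := by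
  have hu : Tendsto (fun k : ℕ => a + 1 / ((k : ℝ) + 1)) atTop (𝓝 a) := by
    simpa using tendsto_const_nhds.add (tendsto_one_div_add_atTop_nhds_zero_nat (𝕜 := ℝ))
  have hu' : Tendsto (fun k : ℕ => a + 1 / ((k : ℝ) + 1)) atTop (𝓝[≠] a) := by
    refine tendsto_nhdsWithin_iff.2 ⟨hu, Eventually.of_forall fun k => ?_⟩
    have : 0 < 1 / ((k : ℝ) + 1) := by positivity
    simp only [mem_compl_iff, mem_singleton_iff]
    linarith
  obtain ⟨N, hN⟩ := eventually_atTop.1 (hu.eventually hF)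
  refine aestronglyMeasurable_of_tendsto_ae atTop
    (f := fun (k : ℕ) x => slope (fun t => F t x) a (a + 1 / (((k + N : ℕ) : ℝ) + 1)))
    (fun k => ?_) ?_
  · simp only [slope_def_field, div_eq_mul_inv]
    exact AEStronglyMeasurable.mul_const ((hN (k + N) (by omega)).sub hF.self_of_nhds) _
  · filter_upwards [h] with x hx
    exact ((hasDerivAt_iff_tendsto_slope.1 hx).comp hu').comp (tendsto_add_atTop_nat N)

theorem MixedDiffAt.hasDerivAt_left {f : ℝ → ℝ → ℝ} {t θ : ℝ} {l : ℕ}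
    (h : MixedDiffAt f t θ (l + 1) 0) :
    HasDerivAt (fun t' => mixedDeriv l 0 f t' θ) (mixedDeriv (l + 1) 0 f t θ) t := by
  have h' : DifferentiableAt ℝ (fun t' => mixedDeriv l 0 f t' θ) t := h
  have h2 := h'.hasDerivAt
  have h3 : deriv (fun t' => mixedDeriv l 0 f t' θ) t = mixedDeriv (l + 1) 0 f t θ := by
    simp only [mixedDeriv, iteratedDeriv_zero, iteratedDeriv_succ]
  rwa [h3] at h2

theorem MixedDiffAt.hasDerivAt_right {f : ℝ → ℝ → ℝ} {t θ : ℝ} {l m : ℕ}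
    (h : MixedDiffAt f t θ l (m + 1)) :
    HasDerivAt (fun θ' => mixedDeriv l m f t θ') (mixedDeriv l (m + 1) f t θ) θ := by
  have h' : DifferentiableAt ℝ (fun θ' => mixedDeriv l m f t θ') θ := by
    cases l <;> exact h
  have h2 := h'.hasDerivAt
  have h3 : deriv (fun θ' => mixedDeriv l m f t θ') θ = mixedDeriv l (m + 1) f t θ := by
    simp only [mixedDeriv, iteratedDeriv_succ]
  rwa [h3] at h2

end Calculus

/-! ### Regularity of the least favorable submodel for one observation. -/

namespace SemiparametricModel

variable {𝒳 : Type*} [MeasurableSpace 𝒳] {E : Type*} [NormedAddCommGroup E]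
  {M : SemiparametricModel 𝒳 E} {θ₀ : ℝ} {η₀ : E} {D : Set (ℝ → E)} {sub : ℝ → ℝ → E → E}
  {ηhat : (n : ℕ) → (Fin n → 𝒳) → ℝ → E}

theorem isProbabilityMeasure_P {θ : ℝ} {η : E} (hθ : θ ∈ M.Θ) (hη : η ∈ M.H) :
    IsProbabilityMeasure (M.P θ η) := by
  constructor
  rw [P, withDensity_apply _ MeasurableSet.univ, Measure.restrict_univ]
  exact M.lintegral_p θ hθ η hη

theorem integral_p {θ : ℝ} {η : E} (hθ : θ ∈ M.Θ) (hη : η ∈ M.H) :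
    Integrable (fun x => (M.p θ η x : ℝ)) M.μ ∧ ∫ x, (M.p θ η x : ℝ) ∂M.μ = 1 := by
  have hm := M.measurable_p θ hθ η hη
  have hl := M.lintegral_p θ hθ η hη
  constructor
  · refine ⟨hm.coe_nnreal_real.aestronglyMeasurable, ?_⟩
    simp only [HasFiniteIntegral]
    have : ∀ x, ‖(M.p θ η x : ℝ)‖ₑ = (M.p θ η x : ℝ≥0∞) := fun x => by simp
    simp only [this, hl]
    exact ENNReal.one_lt_top
  · rw [integral_eq_lintegral_of_nonneg_ae (ae_of_all _ fun x => NNReal.coe_nonneg _)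
      hm.coe_nnreal_real.aestronglyMeasurable]
    simp [hl]

theorem nbhd_mono {ε ε' : ℝ} (h : ε ≤ ε') : M.nbhd θ₀ η₀ ε ⊆ M.nbhd θ₀ η₀ ε' := by
  rintro v ⟨h1, h2, h3, h4, h5, h6⟩
  exact ⟨h1, h2.trans_le h, h3, h4.trans_le h, h5, h6.trans_le h⟩

namespace StandingAssumptions

theorem mem_Θ (hM : M.StandingAssumptions θ₀ η₀ D sub ηhat) : θ₀ ∈ M.Θ :=
  interior_subset hM.mem_interior

theorem isProbabilityMeasure (hM : M.StandingAssumptions θ₀ η₀ D sub ηhat) :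
    IsProbabilityMeasure (M.P θ₀ η₀) :=
  isProbabilityMeasure_P hM.mem_Θ hM.mem_H

theorem exists_ball_subset (hM : M.StandingAssumptions θ₀ η₀ D sub ηhat) :
    ∃ ε > 0, ∀ t, |t - θ₀| < ε → t ∈ M.Θ := by
  obtain ⟨ε, hε, h⟩ := Metric.mem_nhds_iff.1 (mem_interior_iff_mem_nhds.1 hM.mem_interior)
  exact ⟨ε, hε, fun t ht => h (by rwa [Metric.mem_ball, Real.dist_eq])⟩

/-- Derivatives of the log-likelihood of the least favorable submodel, for one observation. -/
structure RegularAt (M : SemiparametricModel 𝒳 E) (sub : ℝ → ℝ → E → E) (θ₀ : ℝ) (η₀ : E)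
    (ε K : ℝ) (x : 𝒳) : Prop where
  pos : ∀ t θ η, |t - θ₀| < ε → |θ - θ₀| < ε → η ∈ M.H → ‖η - η₀‖ < ε → 0 < M.p t (sub t θ η) x
  left : ∀ l < 3, ∀ t θ η, |t - θ₀| < ε → |θ - θ₀| < ε → η ∈ M.H → ‖η - η₀‖ < ε →
    HasDerivAt (fun t' => M.ell sub l 0 t' θ η x) (M.ell sub (l + 1) 0 t θ η x) t
  right : ∀ l m, (l, m) ∈ ({(1, 0), (1, 1), (2, 0)} : Set (ℕ × ℕ)) →
    ∀ t θ η, |t - θ₀| < ε → |θ - θ₀| < ε → η ∈ M.H → ‖η - η₀‖ < ε →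
    HasDerivAt (fun θ' => M.ell sub l m t θ' η x) (M.ell sub l (m + 1) t θ η x) θ
  bound : ∀ o ∈ orders, ∀ t θ η, |t - θ₀| < ε → |θ - θ₀| < ε → η ∈ M.H → ‖η - η₀‖ < ε →
    |M.ell sub o.1 o.2 t θ η x| ≤ K

/-- A common radius inside the interior of `M.Θ` makes membership in `M.Θ` automatic, so that
two-sided derivatives live on open intervals. -/
theorem exists_regularAt (hM : M.StandingAssumptions θ₀ η₀ D sub ηhat) :
    ∃ ε > 0, (∀ t, |t - θ₀| < ε → t ∈ M.Θ) ∧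
      (∀ t θ η, |t - θ₀| < ε → |θ - θ₀| < ε → η ∈ M.H → ‖η - η₀‖ < ε → sub t θ η ∈ M.H) ∧
      ∃ F : 𝒳 → ℝ, Integrable F (M.P θ₀ η₀) ∧
        ∀ᵐ x ∂M.P θ₀ η₀, RegularAt M sub θ₀ η₀ ε (F x) x := by
  obtain ⟨ε₁, hε₁, h₁⟩ := hM.exists_ball_subset
  obtain ⟨ε₂, hε₂, h₂⟩ := hM.sub_mem
  obtain ⟨ε₃, hε₃, F, hF, h₃⟩ := hM.envelope
  have hmem : ∀ t θ η, |t - θ₀| < min ε₁ (min ε₂ ε₃) → |θ - θ₀| < min ε₁ (min ε₂ ε₃) → η ∈ M.H →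
      ‖η - η₀‖ < min ε₁ (min ε₂ ε₃) → (t, θ, η) ∈ M.nbhd θ₀ η₀ (min ε₁ (min ε₂ ε₃)) :=
    fun t θ η ht hθ hη hη' => ⟨h₁ t (ht.trans_le (min_le_left _ _)), ht,
      h₁ θ (hθ.trans_le (min_le_left _ _)), hθ, hη, hη'⟩
  have hle2 : min ε₁ (min ε₂ ε₃) ≤ ε₂ := (min_le_right _ _).trans (min_le_left _ _)
  have hle3 : min ε₁ (min ε₂ ε₃) ≤ ε₃ := (min_le_right _ _).trans (min_le_right _ _)
  refine ⟨min ε₁ (min ε₂ ε₃), by positivity, fun t ht => h₁ t (ht.trans_le (min_le_left _ _)),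
    fun t θ η ht hθ hη hη' => h₂ _ (nbhd_mono hle2 (hmem t θ η ht hθ hη hη')), F, hF, ?_⟩
  filter_upwards [h₃] with x hx
  have hx' := fun t θ η ht hθ hη hη' => hx _ (nbhd_mono hle3 (hmem t θ η ht hθ hη hη'))
  refine ⟨fun t θ η ht hθ hη hη' => (hx' t θ η ht hθ hη hη').1, ?_, ?_, ?_⟩
  · intro l hl t θ η ht hθ hη hη'
    refine ((hx' t θ η ht hθ hη hη').2 (l + 1, 0) ?_).1.hasDerivAt_left
    interval_cases l <;> simp [orders]
  · intro l m hlm t θ η ht hθ hη hη'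
    refine ((hx' t θ η ht hθ hη hη').2 (l, m + 1) ?_).1.hasDerivAt_right
    simp only [mem_insert_iff, Prod.mk.injEq, mem_singleton_iff] at hlm
    rcases hlm with ⟨rfl, rfl⟩ | ⟨rfl, rfl⟩ | ⟨rfl, rfl⟩ <;> simp [orders]
  · intro o ho t θ η ht hθ hη hη'
    exact ((hx' t θ η ht hθ hη hη').2 o ho).2

theorem ell_zero_zero (t θ : ℝ) (η : E) (x : 𝒳) :
    M.ell sub 0 0 t θ η x = Real.log (M.p t (sub t θ η) x) := by
  simp [ell, mixedDeriv, subLogLik, logLik]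

theorem RegularAt.hasDerivAt_density {ε K : ℝ} {x : 𝒳} (h : RegularAt M sub θ₀ η₀ ε K x)
    {t θ : ℝ} {η : E} (ht : |t - θ₀| < ε) (hθ : |θ - θ₀| < ε) (hη : η ∈ M.H)
    (hη' : ‖η - η₀‖ < ε) :
    HasDerivAt (fun t' => (M.p t' (sub t' θ η) x : ℝ))
      (M.ell sub 1 0 t θ η x * M.p t (sub t θ η) x) t := by
  have h1 := (h.left 0 (by norm_num) t θ η ht hθ hη hη').exp
  simp only [ell_zero_zero] at h1
  have hp : ∀ s, |s - θ₀| < ε → Real.exp (Real.log (M.p s (sub s θ η) x)) = M.p s (sub s θ η) x :=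
    fun s hs => Real.exp_log (by exact_mod_cast h.pos s θ η hs hθ hη hη')
  rw [hp t ht, mul_comm] at h1
  refine h1.congr_of_eventuallyEq ?_
  have : ∀ᶠ s in 𝓝 t, |s - θ₀| < ε :=
    (continuous_abs.comp (continuous_id.sub continuous_const)).tendsto t |>.eventually
      (eventually_lt_nhds ht)
  filter_upwards [this] with s hs
  exact (hp s hs).symm

theorem integrable_ell_one {ε : ℝ}
    (hΘ : ∀ t, |t - θ₀| < ε → t ∈ M.Θ)
    (hH : ∀ t θ η, |t - θ₀| < ε → |θ - θ₀| < ε → η ∈ M.H → ‖η - η₀‖ < ε → sub t θ η ∈ M.H)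
    {F : 𝒳 → ℝ} (hF : Integrable F (M.P θ₀ η₀))
    (hreg : ∀ᵐ x ∂M.P θ₀ η₀, RegularAt M sub θ₀ η₀ ε (F x) x)
    {t θ : ℝ} {η : E} (ht : |t - θ₀| < ε) (hθ : |θ - θ₀| < ε) (hη : η ∈ M.H)
    (hη' : ‖η - η₀‖ < ε) :
    Integrable (M.ell sub 1 0 t θ η) (M.P θ₀ η₀) := by
  refine Integrable.mono' hF ?_ ?_
  · refine aestronglyMeasurable_of_hasDerivAt (F := fun t' => M.ell sub 0 0 t' θ η) (a := t) ?_ ?_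
    · have : ∀ᶠ s in 𝓝 t, |s - θ₀| < ε :=
        (continuous_abs.comp (continuous_id.sub continuous_const)).tendsto t |>.eventually
          (eventually_lt_nhds ht)
      filter_upwards [this] with s hs
      have hm := M.measurable_p s (hΘ s hs) _ (hH s θ η hs hθ hη hη')
      have : M.ell sub 0 0 s θ η = fun x => Real.log (M.p s (sub s θ η) x) :=
        funext fun x => ell_zero_zero s θ η x
      rw [this]
      exact (Real.measurable_log.comp hm.coe_nnreal_real).aestronglyMeasurable
    · filter_upwards [hreg] with x hx
      exact hx.left 0 (by norm_num) t θ η ht hθ hη hη'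
  · filter_upwards [hreg] with x hx
    exact hx.bound (1, 0) (by simp [orders]) t θ η ht hθ hη hη'

theorem integrable_ell_two (hM : M.StandingAssumptions θ₀ η₀ D sub ηhat) :
    Integrable (M.ell sub 2 0 θ₀ θ₀ η₀) (M.P θ₀ η₀) := by
  have := hM.isProbabilityMeasure
  obtain ⟨ε, hε, h2, -, -⟩ := hM.classes
  refine (h2.1 _ ⟨(θ₀, θ₀, η₀), ?_, rfl⟩).integrable (by norm_num)
  exact ⟨hM.mem_Θ, by simpa, hM.mem_Θ, by simpa, hM.mem_H, by simpa⟩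

theorem integrable_ell_cross (hM : M.StandingAssumptions θ₀ η₀ D sub ηhat) :
    Integrable (M.ell sub 1 1 θ₀ θ₀ η₀) (M.P θ₀ η₀) := by
  have := hM.isProbabilityMeasure
  obtain ⟨ε, hε, -, h2, -⟩ := hM.classes
  refine (h2.1 _ ⟨(θ₀, θ₀, η₀), ?_, rfl⟩).integrable (by norm_num)
  exact ⟨hM.mem_Θ, by simpa, hM.mem_Θ, by simpa, hM.mem_H, by simpa⟩

theorem memLp_ell_one (hM : M.StandingAssumptions θ₀ η₀ D sub ηhat) :
    MemLp (M.ell sub 1 0 θ₀ θ₀ η₀) 2 (M.P θ₀ η₀) :=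
  (memLp_congr_ae hM.least_favorable).2 (Lp.memLp _)

/-- Along the least favorable submodel the derivative of the log-likelihood in its second
argument is the difference of the ordinary and the efficient score. -/
theorem RegularAt.hasDerivAt_ell_zero_right {ε K : ℝ} {x : 𝒳} (h : RegularAt M sub θ₀ η₀ ε K x)
    (hε : 0 < ε) (hη₀ : η₀ ∈ M.H) (hΘ : ∀ t, |t - θ₀| < ε → t ∈ M.Θ)
    (hdiag : ∀ θ ∈ M.Θ, sub θ θ η₀ = η₀)
    (hx : DifferentiableAt ℝ (fun θ => M.logLik θ η₀ x) θ₀) :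
    HasDerivAt (fun θ => M.ell sub 0 0 θ₀ θ η₀ x)
      (M.score θ₀ η₀ x - M.ell sub 1 0 θ₀ θ₀ η₀ x) θ₀ := by
  have hθ₀ : |θ₀ - θ₀| < ε := by simpa
  have hη : ‖η₀ - η₀‖ < ε := by simpa
  have hK0 : 0 ≤ K := (abs_nonneg _).trans
    (h.bound (1, 0) (by simp [orders]) θ₀ θ₀ η₀ hθ₀ hθ₀ hη₀ hη)
  have hev : ∀ᶠ s in 𝓝 θ₀, |s - θ₀| < ε := by
    filter_upwards [Metric.ball_mem_nhds θ₀ hε] with s hs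
    rwa [Metric.mem_ball, Real.dist_eq] at hs
  -- On the diagonal the submodel is the model with `η₀` fixed, so the derivative there is the
  -- ordinary score.
  have hdiagL : HasDerivAt (fun θ => M.ell sub 0 0 θ θ η₀ x) (M.score θ₀ η₀ x) θ₀ := by
    refine hx.hasDerivAt.congr_of_eventuallyEq ?_
    filter_upwards [hev] with s hs
    rw [ell_zero_zero, hdiag s (hΘ s hs), logLik]
  -- The contribution of the first argument: a Taylor bound in `t` at fixed second argument, plus
  -- the Lipschitz bound of the `t`-derivative in that argument. Each costs `K (t - θ₀)²`.
  -- Subtracting it from the diagonal leaves the contribution of the second argument.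
  have hg : HasDerivAt (fun θ => M.ell sub 0 0 θ θ η₀ x - M.ell sub 0 0 θ₀ θ η₀ x)
      (M.ell sub 1 0 θ₀ θ₀ η₀ x) θ₀ := by
    refine hasDerivAt_of_abs_sub_le_sq (K := 2 * K) hε fun t ht => ?_
    have h1 := abs_sub_sub_le_of_hasDerivAt (f := fun s => M.ell sub 0 0 s t η₀ x)
      (fun s hs => h.left 0 (by norm_num) s t η₀ hs ht hη₀ hη)
      (fun s hs => h.left 1 (by norm_num) s t η₀ hs ht hη₀ hη)
      (fun s hs => h.bound (2, 0) (by simp [orders]) s t η₀ hs ht hη₀ hη) ht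
    have h2 := abs_sub_le_of_hasDerivAt (f := fun s => M.ell sub 1 0 θ₀ s η₀ x)
      (fun s hs => h.right 1 0 (by simp) θ₀ s η₀ hθ₀ hs hη₀ hη)
      (fun s hs => h.bound (1, 1) (by simp [orders]) θ₀ s η₀ hθ₀ hs hη₀ hη) hθ₀ ht
    simp only [sub_self, sub_zero, zero_add] at h1 ⊢
    have h3 : |(t - θ₀) * (M.ell sub 1 0 θ₀ t η₀ x - M.ell sub 1 0 θ₀ θ₀ η₀ x)| ≤
        K * (t - θ₀) ^ 2 := by
      rw [abs_mul, ← sq_abs (t - θ₀)]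
      nlinarith [abs_nonneg (t - θ₀)]
    have h4 : M.ell sub 0 0 t t η₀ x - M.ell sub 0 0 θ₀ t η₀ x -
        (t - θ₀) * M.ell sub 1 0 θ₀ θ₀ η₀ x =
        (M.ell sub 0 0 t t η₀ x - M.ell sub 0 0 θ₀ t η₀ x - (t - θ₀) * M.ell sub 1 0 θ₀ t η₀ x) +
        (t - θ₀) * (M.ell sub 1 0 θ₀ t η₀ x - M.ell sub 1 0 θ₀ θ₀ η₀ x) := by ring
    rw [h4]
    refine (abs_add_le _ _).trans ?_
    linarith
  have := hdiagL.sub hg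
  refine this.congr_of_eventuallyEq (Eventually.of_forall fun θ => ?_)
  simp

end StandingAssumptions

end SemiparametricModel

/-! ### Information identities at the true parameter. -/

theorem integral_deriv_eq_zero {X : Type*} [MeasurableSpace X] {μ : Measure X} {F F' : ℝ → X → ℝ}
    {G : X → ℝ} {a c ε : ℝ} (hF : ∀ t, |t - a| < ε → Integrable (F t) μ)
    (hint : ∀ t, |t - a| < ε → ∫ x, F t x ∂μ = c) (hG : Integrable G μ)
    (h : ∀ᵐ x ∂μ, ∀ t, |t - a| < ε → HasDerivAt (fun s => F s x) (F' t x) t)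
    (hb : ∀ᵐ x ∂μ, ∀ t, |t - a| < ε → |F' t x| ≤ G x) {t : ℝ} (ht : |t - a| < ε) :
    Integrable (F' t) μ ∧ ∫ x, F' t x ∂μ = 0 := by
  have hmem : ∀ᶠ s in 𝓝 t, |s - a| < ε :=
    (continuous_abs.comp (continuous_id.sub continuous_const)).tendsto t |>.eventually
      (eventually_lt_nhds ht)
  have hmeas : ∀ᶠ s in 𝓝 t, AEStronglyMeasurable (F s) μ := hmem.mono fun s hs => (hF s hs).1
  obtain ⟨h1, h2⟩ := hasDerivAt_integral_of_dominated_loc_of_deriv_le (𝕜 := ℝ) (F := F) (F' := F')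
    (bound := G) (s := {s | |s - a| < ε}) hmem hmeas (hF t ht)
    (aestronglyMeasurable_of_hasDerivAt hmeas (h.mono fun x hx => hx t ht))
    (hb.mono fun x hx s hs => hx s hs) hG (h.mono fun x hx s hs => hx s hs)
  refine ⟨h1, h2.unique ((hasDerivAt_const t c).congr_of_eventuallyEq ?_)⟩
  filter_upwards [hmem] with s hs
  exact hint s hs

namespace SemiparametricModel

variable {𝒳 : Type*} [MeasurableSpace 𝒳] {E : Type*} [NormedAddCommGroup E]
  {M : SemiparametricModel 𝒳 E} {θ₀ : ℝ} {η₀ : E} {D : Set (ℝ → E)} {sub : ℝ → ℝ → E → E}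
  {ηhat : (n : ℕ) → (Fin n → 𝒳) → ℝ → E}

namespace StandingAssumptions

/-- The second factor is almost everywhere the projection of the ordinary score on the nuisance
tangent space, to which the efficient score is orthogonal. -/
theorem integral_efficientScore_mul (hM : M.StandingAssumptions θ₀ η₀ D sub ηhat) :
    ∫ x, M.ell sub 1 0 θ₀ θ₀ η₀ x * (M.score θ₀ η₀ x - M.ell sub 1 0 θ₀ θ₀ η₀ x)
      ∂M.P θ₀ η₀ = 0 := by
  set T := M.nuisanceTangentSpace θ₀ η₀ D
  set S := M.scoreLp θ₀ η₀ with hS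
  have horth : inner ℝ (M.efficientScore θ₀ η₀ D) (T.starProjection S) = 0 := by
    have h1 : T.starProjection S ∈ T := Submodule.starProjection_apply_mem T S
    exact Submodule.starProjection_inner_eq_zero S _ h1
  rw [L2.inner_def] at horth
  rw [← horth]
  refine integral_congr_ae ?_
  have hSae : S =ᵐ[M.P θ₀ η₀] M.score θ₀ η₀ := by
    rw [hS, scoreLp, dif_pos hM.score_memLp]
    exact MemLp.coeFn_toLp _
  have hdiff : (M.efficientScore θ₀ η₀ D : 𝒳 → ℝ) =ᵐ[M.P θ₀ η₀] S - T.starProjection S :=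
    Lp.coeFn_sub _ _
  filter_upwards [hM.least_favorable, hSae, hdiff] with x h1 h2 h3
  rw [h1]
  simp only [Pi.sub_apply] at h3
  have h4 : (T.starProjection S : 𝒳 → ℝ) x = M.score θ₀ η₀ x - M.efficientScore θ₀ η₀ D x := by
    rw [h3, ← h2]; ring
  rw [h4]
  simp [mul_comm]

/-- Differentiate `∫ p_{t, η_t(θ, η₀)} dμ = 1` at `(θ₀, θ₀)`. The `t`-derivative gives mean zero and
the `tt`-derivative gives `P(ℓ̈₀ + ℓ̇₀²) = 0`. The `tθ`-derivative gives `P(ℓ_{t,θ} + ℓ̇₀ ∂_θ ℓ) =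
0`, where `∂_θ ℓ` is the ordinary minus the efficient score, so that the product term vanishes by
orthogonality. -/
theorem integral_ell (hM : M.StandingAssumptions θ₀ η₀ D sub ηhat) :
    ∫ x, M.ell sub 1 0 θ₀ θ₀ η₀ x ∂M.P θ₀ η₀ = 0 ∧
    ∫ x, M.ell sub 2 0 θ₀ θ₀ η₀ x ∂M.P θ₀ η₀ = -M.efficientInfo θ₀ η₀ D ∧
    ∫ x, M.ell sub 1 1 θ₀ θ₀ η₀ x ∂M.P θ₀ η₀ = 0 := by
  have := hM.isProbabilityMeasure
  obtain ⟨ε₁, hε₁, hΘ₁, hH₁, F, hF, hreg₁⟩ := hM.exists_regularAt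
  obtain ⟨ε₂, hε₂, G, hG, hden₁⟩ := hM.density_envelope
  have hη₁ : ‖η₀ - η₀‖ < ε₁ := by simpa
  have hηH := hM.mem_H
  set ε := min ε₁ ε₂ with hεdef
  have hε : 0 < ε := by positivity
  have hθ₀ : |θ₀ - θ₀| < ε := by simpa
  have hle₁ : ∀ {t : ℝ}, |t - θ₀| < ε → |t - θ₀| < ε₁ := fun h => h.trans_le (min_le_left _ _)
  have hle₂ : ∀ {t : ℝ}, |t - θ₀| < ε → |t - θ₀| < ε₂ := fun h => h.trans_le (min_le_right _ _)
  have hdiag : ∀ θ ∈ M.Θ, sub θ θ η₀ = η₀ := fun θ hθ => hM.sub_diag θ hθ η₀ hηH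
  have hdiag₀ := hdiag θ₀ hM.mem_Θ
  let q : ℝ → ℝ → 𝒳 → ℝ := fun t θ x => M.p t (sub t θ η₀) x
  have hq : ∀ t θ x, q t θ x = mixedDeriv 0 0 (M.subDensity sub η₀ x) t θ := fun t θ x => by
    simp [q, mixedDeriv, subDensity]
  have hqint : ∀ t θ, |t - θ₀| < ε → |θ - θ₀| < ε → Integrable (q t θ) M.μ ∧
      ∫ x, q t θ x ∂M.μ = 1 := fun t θ ht hθ =>
    integral_p (hΘ₁ t (hle₁ ht)) (hH₁ t θ η₀ (hle₁ ht) (hle₁ hθ) hηH hη₁)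
  let q' : ℝ → ℝ → 𝒳 → ℝ := fun t θ x => mixedDeriv 1 0 (M.subDensity sub η₀ x) t θ
  let qtt : ℝ → 𝒳 → ℝ := fun t x => mixedDeriv 2 0 (M.subDensity sub η₀ x) t θ₀
  let qtθ : ℝ → 𝒳 → ℝ := fun θ x => mixedDeriv 1 1 (M.subDensity sub η₀ x) θ₀ θ
  -- integrals of the derivatives of the density
  have hI1 : ∀ t θ, |t - θ₀| < ε → |θ - θ₀| < ε → Integrable (q' t θ) M.μ ∧
      ∫ x, q' t θ x ∂M.μ = 0 := by
    intro t θ ht hθ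
    refine integral_deriv_eq_zero (F := fun s => q s θ) (F' := fun s => q' s θ)
      (fun s hs => (hqint s θ hs hθ).1) (fun s hs => (hqint s θ hs hθ).2) hG ?_ ?_ ht
    · filter_upwards [hden₁] with x hx s hs
      simp only [hq]
      exact ((hx s θ (hle₂ hs) (hle₂ hθ)).2 (1, 0) (by simp)).1.hasDerivAt_left
    · filter_upwards [hden₁] with x hx s hs
      exact ((hx s θ (hle₂ hs) (hle₂ hθ)).2 (1, 0) (by simp)).2
  have hI2 : Integrable (qtt θ₀) M.μ ∧ ∫ x, qtt θ₀ x ∂M.μ = 0 := by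
    refine integral_deriv_eq_zero (F := fun s => q' s θ₀) (F' := qtt)
      (fun s hs => (hI1 s θ₀ hs hθ₀).1) (fun s hs => (hI1 s θ₀ hs hθ₀).2) hG ?_ ?_ hθ₀
    · filter_upwards [hden₁] with x hx s hs
      exact ((hx s θ₀ (hle₂ hs) (hle₂ hθ₀)).2 (2, 0) (by simp)).1.hasDerivAt_left
    · filter_upwards [hden₁] with x hx s hs
      exact ((hx s θ₀ (hle₂ hs) (hle₂ hθ₀)).2 (2, 0) (by simp)).2
  have hI3 : Integrable (qtθ θ₀) M.μ ∧ ∫ x, qtθ θ₀ x ∂M.μ = 0 := by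
    refine integral_deriv_eq_zero (F := fun s => q' θ₀ s) (F' := qtθ)
      (fun s hs => (hI1 θ₀ s hθ₀ hs).1) (fun s hs => (hI1 θ₀ s hθ₀ hs).2) hG ?_ ?_ hθ₀
    · filter_upwards [hden₁] with x hx s hs
      exact ((hx θ₀ s (hle₂ hθ₀) (hle₂ hs)).2 (1, 1) (by simp)).1.hasDerivAt_right
    · filter_upwards [hden₁] with x hx s hs
      exact ((hx θ₀ s (hle₂ hθ₀) (hle₂ hs)).2 (1, 1) (by simp)).2
  -- the derivatives of the density in terms of those of the log-likelihood
  have hpm : Measurable (M.p θ₀ η₀) := M.measurable_p θ₀ hM.mem_Θ η₀ hηH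
  have hev : ∀ᶠ s in 𝓝 θ₀, |s - θ₀| < ε := by
    filter_upwards [Metric.ball_mem_nhds θ₀ hε] with s hs
    rwa [Metric.mem_ball, Real.dist_eq] at hs
  have hae : ∀ᵐ x ∂M.μ, (M.p θ₀ η₀ x : ℝ≥0∞) ≠ 0 →
      RegularAt M sub θ₀ η₀ ε₁ (F x) x ∧ DifferentiableAt ℝ (fun θ => M.logLik θ η₀ x) θ₀ :=
    (ae_withDensity_iff hpm.coe_nnreal_ennreal).1 (hreg₁.and hM.score_diff)
  have hpt : ∀ᵐ x ∂M.μ,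
      q' θ₀ θ₀ x = M.p θ₀ η₀ x • M.ell sub 1 0 θ₀ θ₀ η₀ x ∧
      qtt θ₀ x = M.p θ₀ η₀ x • (M.ell sub 2 0 θ₀ θ₀ η₀ x + M.ell sub 1 0 θ₀ θ₀ η₀ x ^ 2) ∧
      qtθ θ₀ x = M.p θ₀ η₀ x • (M.ell sub 1 1 θ₀ θ₀ η₀ x + M.ell sub 1 0 θ₀ θ₀ η₀ x *
        (M.score θ₀ η₀ x - M.ell sub 1 0 θ₀ θ₀ η₀ x)) := by
    filter_upwards [hae, hden₁] with x hx hxd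
    have hd1 : ∀ t θ, |t - θ₀| < ε → |θ - θ₀| < ε →
        HasDerivAt (fun s => q s θ x) (q' t θ x) t := fun t θ ht hθ => by
      simp only [hq]
      exact ((hxd t θ (hle₂ ht) (hle₂ hθ)).2 (1, 0) (by simp)).1.hasDerivAt_left
    have hd2 : HasDerivAt (fun s => q' s θ₀ x) (qtt θ₀ x) θ₀ :=
      ((hxd θ₀ θ₀ (hle₂ hθ₀) (hle₂ hθ₀)).2 (2, 0) (by simp)).1.hasDerivAt_left
    have hd3 : HasDerivAt (fun s => q' θ₀ s x) (qtθ θ₀ x) θ₀ :=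
      ((hxd θ₀ θ₀ (hle₂ hθ₀) (hle₂ hθ₀)).2 (1, 1) (by simp)).1.hasDerivAt_right
    have hevt : ∀ t, |t - θ₀| < ε → ∀ᶠ s in 𝓝 t, |s - θ₀| < ε := fun t ht =>
      (continuous_abs.comp (continuous_id.sub continuous_const)).tendsto t |>.eventually
        (eventually_lt_nhds ht)
    by_cases h0 : M.p θ₀ η₀ x = 0
    -- Off the support of the true density nothing is known about the log-likelihood, but there all
    -- nearby densities vanish, hence so do their derivatives.
    · have hq0 : ∀ t θ, |t - θ₀| < ε → |θ - θ₀| < ε → q' t θ x = 0 := fun t θ ht hθ => by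
        refine (hd1 t θ ht hθ).unique ((hasDerivAt_const t (0 : ℝ)).congr_of_eventuallyEq ?_)
        filter_upwards [hevt t ht] with s hs
        simp [q, (hxd s θ (hle₂ hs) (hle₂ hθ)).1 h0]
      refine ⟨by simp [h0, hq0 θ₀ θ₀ hθ₀ hθ₀], ?_, ?_⟩
      · rw [h0, zero_smul]
        refine hd2.unique ((hasDerivAt_const θ₀ (0 : ℝ)).congr_of_eventuallyEq ?_)
        filter_upwards [hev] with s hs
        exact hq0 s θ₀ hs hθ₀
      · rw [h0, zero_smul]
        refine hd3.unique ((hasDerivAt_const θ₀ (0 : ℝ)).congr_of_eventuallyEq ?_)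
        filter_upwards [hev] with s hs
        exact hq0 θ₀ s hθ₀ hs
    · obtain ⟨hr, hs⟩ := hx (by exact_mod_cast h0)
      have hq1 : ∀ t θ, |t - θ₀| < ε → |θ - θ₀| < ε → q' t θ x = M.ell sub 1 0 t θ η₀ x * q t θ x :=
        fun t θ ht hθ => (hd1 t θ ht hθ).unique
          (hr.hasDerivAt_density (hle₁ ht) (hle₁ hθ) hηH hη₁)
      have hq00 : q θ₀ θ₀ x = M.p θ₀ η₀ x := by simp only [q, hdiag₀]
      refine ⟨?_, ?_, ?_⟩
      · rw [hq1 θ₀ θ₀ hθ₀ hθ₀, hq00, NNReal.smul_def, smul_eq_mul, mul_comm]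
      · have h1 := (hr.left 1 (by norm_num) θ₀ θ₀ η₀ (hle₁ hθ₀) (hle₁ hθ₀) hηH hη₁).mul
          (hd1 θ₀ θ₀ hθ₀ hθ₀)
        have h2 := hd2.unique (h1.congr_of_eventuallyEq (by
          filter_upwards [hev] with s hs
          exact hq1 s θ₀ hs hθ₀))
        rw [h2, hq1 θ₀ θ₀ hθ₀ hθ₀, hq00, NNReal.smul_def, smul_eq_mul]
        ring
      -- `∂_t q = ℓ̇ q` is differentiated in `θ` by the product rule; the `θ`-derivative of `q`
      -- comes from exponentiating that of `ℓ`.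
      · have hexp := (hr.hasDerivAt_ell_zero_right hε₁ hηH hΘ₁ hdiag hs).exp
        have hqe : ∀ s, |s - θ₀| < ε → Real.exp (M.ell sub 0 0 θ₀ s η₀ x) = q θ₀ s x := fun s hs => by
          rw [ell_zero_zero, Real.exp_log]
          exact_mod_cast hr.pos θ₀ s η₀ (hle₁ hθ₀) (hle₁ hs) hηH hη₁
        rw [hqe θ₀ hθ₀, hq00] at hexp
        have hqd := hexp.congr_of_eventuallyEq (f₁ := fun s => q θ₀ s x) (by
          filter_upwards [hev] with s hs
          exact (hqe s hs).symm)
        have h1 := (hr.right 1 0 (by simp) θ₀ θ₀ η₀ (hle₁ hθ₀) (hle₁ hθ₀) hηH hη₁).mul hqd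
        have h2 := hd3.unique (h1.congr_of_eventuallyEq (by
          filter_upwards [hev] with s hs
          exact hq1 θ₀ s hθ₀ hs))
        rw [h2, hq00, NNReal.smul_def, smul_eq_mul]
        ring
  -- transfer to integrals with respect to `P`
  have hell1 := hM.memLp_ell_one
  have hE1 : ∫ x, M.ell sub 1 0 θ₀ θ₀ η₀ x ∂M.P θ₀ η₀ = 0 := by
    rw [P, integral_withDensity_eq_integral_smul hpm, ← (hI1 θ₀ θ₀ hθ₀ hθ₀).2]
    exact integral_congr_ae (hpt.mono fun x hx => hx.1.symm)
  have hE2 : ∫ x, (M.ell sub 2 0 θ₀ θ₀ η₀ x + M.ell sub 1 0 θ₀ θ₀ η₀ x ^ 2) ∂M.P θ₀ η₀ = 0 := by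
    rw [P, integral_withDensity_eq_integral_smul hpm, ← hI2.2]
    exact integral_congr_ae (hpt.mono fun x hx => hx.2.1.symm)
  have hE3 : ∫ x, (M.ell sub 1 1 θ₀ θ₀ η₀ x + M.ell sub 1 0 θ₀ θ₀ η₀ x *
      (M.score θ₀ η₀ x - M.ell sub 1 0 θ₀ θ₀ η₀ x)) ∂M.P θ₀ η₀ = 0 := by
    rw [P, integral_withDensity_eq_integral_smul hpm, ← hI3.2]
    exact integral_congr_ae (hpt.mono fun x hx => hx.2.2.symm)
  refine ⟨hE1, ?_, ?_⟩
  · rw [integral_add hM.integrable_ell_two hell1.integrable_sq] at hE2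
    have hvar : M.efficientInfo θ₀ η₀ D = ∫ x, M.ell sub 1 0 θ₀ θ₀ η₀ x ^ 2 ∂M.P θ₀ η₀ := by
      rw [efficientInfo, ← variance_congr hM.least_favorable, variance_eq_sub hell1, hE1]
      simp
    linarith
  · have hi : Integrable (fun x => M.ell sub 1 0 θ₀ θ₀ η₀ x *
        (M.score θ₀ η₀ x - M.ell sub 1 0 θ₀ θ₀ η₀ x)) (M.P θ₀ η₀) :=
      hell1.integrable_mul (hM.score_memLp.sub hell1)
    rw [integral_add hM.integrable_ell_cross hi, hM.integral_efficientScore_mul] at hE3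
    simpa using hE3

end StandingAssumptions

end SemiparametricModel

/-! ### Deterministic expansions of the submodel scores and of the profile. -/

theorem abs_score_expansion_le {a₁₀ a₂₀ a₃₀ a₁₁ a₁₂ a₂₁ : ℝ → ℝ → ℝ} {θ₀ ε K W I h e : ℝ}
    (hε : 0 < ε) (hK : 1 ≤ K) (hh : 0 ≤ h) (he : 0 ≤ e)
    (d₁ : ∀ t θ, |t - θ₀| < ε → |θ - θ₀| < ε → HasDerivAt (fun t => a₁₀ t θ) (a₂₀ t θ) t)
    (d₂ : ∀ t θ, |t - θ₀| < ε → |θ - θ₀| < ε → HasDerivAt (fun t => a₂₀ t θ) (a₃₀ t θ) t)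
    (d₃ : ∀ θ, |θ - θ₀| < ε → HasDerivAt (fun θ => a₁₀ θ₀ θ) (a₁₁ θ₀ θ) θ)
    (d₄ : ∀ θ, |θ - θ₀| < ε → HasDerivAt (fun θ => a₁₁ θ₀ θ) (a₁₂ θ₀ θ) θ)
    (d₅ : ∀ θ, |θ - θ₀| < ε → HasDerivAt (fun θ => a₂₀ θ₀ θ) (a₂₁ θ₀ θ) θ)
    (b₃₀ : ∀ t θ, |t - θ₀| < ε → |θ - θ₀| < ε → |a₃₀ t θ| ≤ K)
    (b₁₂ : ∀ θ, |θ - θ₀| < ε → |a₁₂ θ₀ θ| ≤ K) (b₂₁ : ∀ θ, |θ - θ₀| < ε → |a₂₁ θ₀ θ| ≤ K)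
    (h₁ : |a₁₀ θ₀ θ₀ - W| ≤ K * (h * e + e ^ 2)) (h₂ : |a₁₁ θ₀ θ₀| ≤ K * (h + e))
    (h₃ : |a₂₀ θ₀ θ₀ + I| ≤ K * (h + e))
    {θ : ℝ} (hθ : |θ - θ₀| < ε) (heθ : e ≤ K * (h + |θ - θ₀|)) {t : ℝ} (ht : |t - θ₀| < ε) :
    |a₁₀ t θ - W + I * (t - θ₀)| ≤ 9 * K ^ 3 * (h + |θ - θ₀| + |t - θ₀|) ^ 2 := by
  have h0 : |θ₀ - θ₀| < ε := by simpa
  -- In the application `h = n^{-1/2}`, `e = ‖η̂_θ - η₀‖`, `W = ℙ_n ℓ̃₀`. Expand in `t` at fixed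
  -- `θ`, then move `θ` to `θ₀`: every error is a product of two small quantities, each at most a
  -- multiple of `h + |θ - θ₀| + |t - θ₀|`.
  have e₁ := abs_sub_sub_le_of_hasDerivAt (f := fun t => a₁₀ t θ) (fun s hs => d₁ s θ hs hθ)
    (fun s hs => d₂ s θ hs hθ) (fun s hs => b₃₀ s θ hs hθ) ht
  have e₂ := abs_sub_sub_le_of_hasDerivAt d₃ d₄ b₁₂ hθ
  have e₃ := abs_sub_le_of_hasDerivAt d₅ b₂₁ h0 hθ
  set a := |θ - θ₀| with ha
  set τ := |t - θ₀| with hτ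
  have ha0 : 0 ≤ a := abs_nonneg _
  have hτ0 : 0 ≤ τ := abs_nonneg _
  set s := h + a + τ with hs
  have hs0 : 0 ≤ s := by positivity
  have hK0 : 0 ≤ K := by linarith
  rw [← sq_abs, ← hτ] at e₁
  rw [← sq_abs, ← ha] at e₂
  have eq : a₁₀ t θ - W + I * (t - θ₀) =
      (a₁₀ t θ - a₁₀ θ₀ θ - (t - θ₀) * a₂₀ θ₀ θ) +
      ((t - θ₀) * (a₂₀ θ₀ θ - a₂₀ θ₀ θ₀) + (t - θ₀) * (a₂₀ θ₀ θ₀ + I)) +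
      ((a₁₀ θ₀ θ - a₁₀ θ₀ θ₀ - (θ - θ₀) * a₁₁ θ₀ θ₀) + (θ - θ₀) * a₁₁ θ₀ θ₀) +
      (a₁₀ θ₀ θ₀ - W) := by ring
  have hes : e ≤ K * s := heθ.trans (mul_le_mul_of_nonneg_left (by linarith) hK0)
  have hhs : h ≤ s := by linarith
  have has : a ≤ s := by linarith
  have hτs : τ ≤ s := by linarith
  have hKK : K ≤ K ^ 2 := by nlinarith
  have hKKK : K ^ 2 ≤ K ^ 3 := by nlinarith [sq_nonneg K]
  have hhe : h + e ≤ (1 + K) * s := by linarith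
  have f₁ : K * τ ^ 2 ≤ K * s ^ 2 := by gcongr
  have f₂ : |(t - θ₀) * (a₂₀ θ₀ θ - a₂₀ θ₀ θ₀)| ≤ K * s ^ 2 := by
    rw [abs_mul, ← hτ]
    calc τ * |a₂₀ θ₀ θ - a₂₀ θ₀ θ₀| ≤ s * (K * s) :=
          mul_le_mul hτs (e₃.trans (by gcongr)) (abs_nonneg _) hs0
      _ = K * s ^ 2 := by ring
  have f₃ : |(t - θ₀) * (a₂₀ θ₀ θ₀ + I)| ≤ K * (1 + K) * s ^ 2 := by
    rw [abs_mul, ← hτ]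
    calc τ * |a₂₀ θ₀ θ₀ + I| ≤ s * (K * ((1 + K) * s)) :=
          mul_le_mul hτs (h₃.trans (by gcongr)) (abs_nonneg _) hs0
      _ = K * (1 + K) * s ^ 2 := by ring
  have f₄ : K * a ^ 2 ≤ K * s ^ 2 := by gcongr
  have f₅ : |(θ - θ₀) * a₁₁ θ₀ θ₀| ≤ K * (1 + K) * s ^ 2 := by
    rw [abs_mul, ← ha]
    calc a * |a₁₁ θ₀ θ₀| ≤ s * (K * ((1 + K) * s)) :=
          mul_le_mul has (h₂.trans (by gcongr)) (abs_nonneg _) hs0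
      _ = K * (1 + K) * s ^ 2 := by ring
  have f₆ : K * (h * e + e ^ 2) ≤ K * (s * (K * s) + (K * s) ^ 2) := by gcongr
  -- The coefficients 5, 3 and 1 add up to the 9 of the conclusion, as `1 ≤ K` gives `K ≤ K² ≤ K³`.
  have tot : |a₁₀ t θ - W + I * (t - θ₀)| ≤ (5 * K + 3 * K ^ 2 + K ^ 3) * s ^ 2 := by
    rw [eq]
    refine (abs_add_le _ _).trans ?_
    refine (add_le_add (abs_add_three _ _ _) le_rfl).trans ?_
    have g₁ := abs_add_le ((t - θ₀) * (a₂₀ θ₀ θ - a₂₀ θ₀ θ₀)) ((t - θ₀) * (a₂₀ θ₀ θ₀ + I))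
    have g₂ := abs_add_le (a₁₀ θ₀ θ - a₁₀ θ₀ θ₀ - (θ - θ₀) * a₁₁ θ₀ θ₀) ((θ - θ₀) * a₁₁ θ₀ θ₀)
    have : (5 * K + 3 * K ^ 2 + K ^ 3) * s ^ 2 = K * s ^ 2 + (K * s ^ 2 + K * (1 + K) * s ^ 2) +
      (K * s ^ 2 + K * (1 + K) * s ^ 2) + K * (s * (K * s) + (K * s) ^ 2) := by ring
    linarith
  refine tot.trans (mul_le_mul_of_nonneg_right ?_ (sq_nonneg s))
  linarith

theorem abs_sub_le_of_hasDerivAt_uIcc {f f' : ℝ → ℝ} {s t C : ℝ}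
    (hf : ∀ u ∈ uIcc s t, HasDerivAt f (f' u) u) (hC : ∀ u ∈ uIcc s t, |f' u| ≤ C) :
    |f t - f s| ≤ C * |t - s| :=
  (convex_uIcc s t).norm_image_sub_le_of_norm_hasDerivWithin_le
    (fun u hu => (hf u hu).hasDerivWithinAt) hC left_mem_uIcc right_mem_uIcc

/-- Quadratic expansion of a profile `t ↦ a t t` around its maximiser `θhat`, from a linear
expansion of the derivatives of the submodels `a · θ` that it dominates. -/
theorem abs_profile_expansion_le {a a' : ℝ → ℝ → ℝ} {θ₀ δ δ' C K W I h θhat : ℝ}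
    (hI : 0 < I) (hC : 0 ≤ C) (hK : 0 ≤ K) (hh : 0 ≤ h) (hδ : δ' ≤ δ) (hCδ : C * (3 * δ') ≤ I / 4)
    (hhδ : h ≤ δ')
    (hd : ∀ t θ, |t - θ₀| < δ → |θ - θ₀| < δ → HasDerivAt (fun t => a t θ) (a' t θ) t)
    (hb : ∀ t θ, |t - θ₀| < δ → |θ - θ₀| < δ →
      |a' t θ - W + I * (t - θ₀)| ≤ C * (h + |θ - θ₀| + |t - θ₀|) ^ 2)
    (hmax : ∀ t θ, |t - θ₀| < δ → |θ - θ₀| < δ → a t θ ≤ a t t)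
    (hθhat : |θhat - θ₀| < δ') (hhat : ∀ t, |t - θ₀| < δ → a t t ≤ a θhat θhat)
    (hW : |W| ≤ K * h) :
    |θhat - θ₀| ≤ (2 * K / I + 1 / 2) * h ∧ ∀ θ, |θ - θ₀| < δ →
      |a θ θ - a θhat θhat + I / 2 * (θ - θhat) ^ 2| ≤
        2 * C * (2 + 2 * (2 * K / I + 1 / 2)) ^ 2 * (h + |θ - θhat|) ^ 3 := by
  set B := 2 * K / I + 1 / 2 with hB
  have hB0 : 0 ≤ B := by positivity
  have hθδ : |θhat - θ₀| < δ := hθhat.trans_le hδ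
  set b := |θhat - θ₀| with hbdef
  have hb0 : 0 ≤ b := abs_nonneg _
  -- `a t θhat ≤ a t t ≤ a θhat θhat`, so `θhat` is a critical point of its own submodel.
  have hzero : a' θhat θhat = 0 := by
    refine IsLocalMax.hasDerivAt_eq_zero ?_ (hd θhat θhat hθδ hθδ)
    have : ∀ᶠ s in 𝓝 θhat, |s - θ₀| < δ :=
      (continuous_abs.comp (continuous_id.sub continuous_const)).tendsto θhat |>.eventually
        (eventually_lt_nhds hθδ)
    filter_upwards [this] with s hs
    exact (hmax s θhat hs hθδ).trans (hhat s hs)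
  have hWb : |W - I * (θhat - θ₀)| ≤ C * (h + 2 * b) ^ 2 := by
    have := hb θhat θhat hθδ hθδ
    rw [hzero] at this
    rw [abs_sub_comm]
    convert this using 2
    · ring
    · rw [← hbdef]; ring
  have hbB : b ≤ B * h := by
    have h1 : I * b ≤ K * h + C * (h + 2 * b) ^ 2 := by
      have h2 : I * b = |I * (θhat - θ₀)| := by rw [abs_mul, abs_of_pos hI]
      have h3 : I * (θhat - θ₀) = W - (W - I * (θhat - θ₀)) := by ring
      rw [h2, h3]
      exact (abs_sub _ _).trans (add_le_add hW hWb)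
    -- Consistency makes one factor `h + 2b` at most `3δ'`, so the quadratic error becomes linear
    -- and its part in `b` is absorbed on the left. What remains is `(I/2) b ≤ (K + I/4) h`, the
    -- origin of `B`.
    have h4 : C * (h + 2 * b) ^ 2 ≤ I / 4 * (h + 2 * b) := by
      calc C * (h + 2 * b) ^ 2 = C * (h + 2 * b) * (h + 2 * b) := by ring
        _ ≤ C * (3 * δ') * (h + 2 * b) := by
          gcongr; linarith
        _ ≤ I / 4 * (h + 2 * b) := by gcongr
    have h5 : I / 2 * b ≤ (K + I / 4) * h := by linarith
    have h6 : B * h = (K + I / 4) * h / (I / 2) := by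
      rw [hB]; field_simp; ring
    rw [h6, le_div_iff₀ (by positivity)]
    linarith
  refine ⟨hbB, fun θ hθ => ?_⟩
  set s := h + |θ - θhat| with hs
  have hs0 : 0 ≤ s := by positivity
  have hhs : h ≤ s := by simp [hs]
  have hθs : |θ - θhat| ≤ s := by simp [hs, hh]
  -- The score of the submodel with second argument frozen at `ϑ` is integrated from `θhat` to `θ`;
  -- its linear part is recentred from `θ₀` to `θhat` by `hWb`, hence the factor 2.
  have key : ∀ ϑ, |ϑ - θ₀| < δ → |ϑ - θhat| ≤ |θ - θhat| →
      |a θ ϑ - a θhat ϑ + I / 2 * (θ - θhat) ^ 2| ≤ 2 * C * (2 + 2 * B) ^ 2 * s ^ 3 := by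
    intro ϑ hϑ hϑ'
    have hseg : ∀ u ∈ uIcc θhat θ, |u - θ₀| < δ := by
      intro u hu
      have hball := (convex_ball θ₀ δ).segment_subset (x := θhat) (y := θ)
        (by rwa [Metric.mem_ball, Real.dist_eq]) (by rwa [Metric.mem_ball, Real.dist_eq])
      rw [segment_eq_uIcc] at hball
      have := hball hu
      rwa [Metric.mem_ball, Real.dist_eq] at this
    have hmv := abs_sub_le_of_hasDerivAt_uIcc
      (f := fun t => a t ϑ + I / 2 * (t - θhat) ^ 2) (f' := fun t => a' t ϑ + I * (t - θhat))
      (s := θhat) (t := θ) (C := 2 * C * ((2 + 2 * B) * s) ^ 2) (fun u hu => ?_) (fun u hu => ?_)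
    · calc |a θ ϑ - a θhat ϑ + I / 2 * (θ - θhat) ^ 2|
          = |a θ ϑ + I / 2 * (θ - θhat) ^ 2 - (a θhat ϑ + I / 2 * (θhat - θhat) ^ 2)| := by
            congr 1; ring
        _ ≤ 2 * C * ((2 + 2 * B) * s) ^ 2 * |θ - θhat| := hmv
        _ ≤ 2 * C * ((2 + 2 * B) * s) ^ 2 * s := by gcongr
        _ = _ := by ring
    · have h1 : HasDerivAt (fun t => I / 2 * (t - θhat) ^ 2) (I * (u - θhat)) u := by
        have := (((hasDerivAt_id u).sub_const θhat).pow 2).const_mul (I / 2)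
        exact this.congr_deriv (by simp only [id_eq, Nat.cast_ofNat]; ring)
      exact (hd u ϑ (hseg u hu) hϑ).add h1
    · have h1 := hb u ϑ (hseg u hu) hϑ
      have hu1 : |u - θhat| ≤ |θ - θhat| := abs_sub_left_of_mem_uIcc hu
      have hu2 : |u - θ₀| ≤ |θ - θhat| + b := by
        have := abs_sub_le u θhat θ₀
        linarith
      have hϑ2 : |ϑ - θ₀| ≤ |θ - θhat| + b := by
        have := abs_sub_le ϑ θhat θ₀
        linarith
      have hb2 : b ≤ B * s := hbB.trans (by gcongr)
      have h2 : h + |ϑ - θ₀| + |u - θ₀| ≤ (2 + 2 * B) * s := by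
        have : h + 2 * |θ - θhat| ≤ 2 * s := by rw [hs]; linarith
        linarith
      have h3 : h + 2 * b ≤ (2 + 2 * B) * s := by linarith
      have h4 : a' u ϑ + I * (u - θhat) =
          (a' u ϑ - W + I * (u - θ₀)) + (W - I * (θhat - θ₀)) := by ring
      rw [h4]
      refine (abs_add_le _ _).trans ?_
      have h5 : C * (h + |ϑ - θ₀| + |u - θ₀|) ^ 2 ≤ C * ((2 + 2 * B) * s) ^ 2 := by gcongr
      have h6 : C * (h + 2 * b) ^ 2 ≤ C * ((2 + 2 * B) * s) ^ 2 := by gcongr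
      linarith
  -- Sandwich: `a θ θhat - a θhat θhat ≤ a θ θ - a θhat θhat ≤ a θ θ - a θhat θ`.
  have k₁ := key θ hθ le_rfl
  have k₂ := key θhat hθδ (by simp)
  have m₁ := hmax θhat θ hθδ hθ
  have m₂ := hmax θ θhat hθ hθδ
  rw [abs_le] at k₁ k₂ ⊢
  constructor <;> linarith [k₁.1, k₁.2, k₂.1, k₂.2]

/-! ### Comparison of a perturbed Gaussian density with the Gaussian. -/

theorem abs_exp_sub_one_le_mul_exp_abs (r : ℝ) : |Real.exp r - 1| ≤ |r| * Real.exp |r| := by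
  have h1 := Real.add_one_le_exp (-r)
  have h2 := Real.add_one_le_exp r
  have h3 : Real.exp (-r) * Real.exp r = 1 := by rw [← Real.exp_add]; simp
  have h4 : Real.exp r ≤ Real.exp |r| := Real.exp_le_exp.2 (le_abs_self r)
  have h5 : 1 ≤ Real.exp |r| := Real.one_le_exp (abs_nonneg r)
  have h6 := Real.exp_pos r
  have h7 := abs_nonneg r
  rw [abs_le]
  constructor
  · nlinarith [neg_abs_le r]
  · have : Real.exp r - 1 ≤ r * Real.exp r := by nlinarith
    refine this.trans ?_
    calc r * Real.exp r ≤ |r| * Real.exp r := by gcongr; exact le_abs_self r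
      _ ≤ |r| * Real.exp |r| := by gcongr

/-- `3|y| ≤ 18/I + I y²/8` by completing the square: the cubic factor costs only part of the
Gaussian exponent. -/
theorem one_add_abs_pow_three_le {I : ℝ} (hI : 0 < I) (y : ℝ) :
    (1 + |y|) ^ 3 ≤ Real.exp (18 / I) * Real.exp (I * y ^ 2 / 8) := by
  have h1 : 1 + |y| ≤ Real.exp |y| := by rw [add_comm]; exact Real.add_one_le_exp _
  have h2 : (1 + |y|) ^ 3 ≤ Real.exp (3 * |y|) := by
    have : Real.exp (3 * |y|) = Real.exp |y| ^ 3 := by rw [← Real.exp_nat_mul]; norm_num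
    rw [this]; gcongr
  refine h2.trans ?_
  rw [← Real.exp_add]
  refine Real.exp_le_exp.2 ?_
  have h3 : 18 / I + I * y ^ 2 / 8 - 3 * |y| = (I * |y| - 12) ^ 2 / (8 * I) := by
    rw [← sq_abs y]; field_simp; ring
  have h4 : 0 ≤ (I * |y| - 12) ^ 2 / (8 * I) := by positivity
  linarith

theorem integral_comp_mul_sub (f : ℝ → ℝ) {s : ℝ} (hs : 0 < s) (a : ℝ) :
    ∫ θ, f (s * (θ - a)) = s⁻¹ * ∫ y, f y := by
  rw [integral_sub_right_eq_self (fun θ => f (s * θ)) a, Measure.integral_comp_mul_left f s,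
    abs_of_pos (inv_pos.2 hs), smul_eq_mul]

theorem cdf_gaussianReal_eq_div {n I r a : ℝ} (hn : 0 < n) (hI : 0 < I) (hr : 0 < r) (ξ : ℝ) :
    Integrable (fun θ => r * Real.exp (-(n * I / 2 * (θ - a) ^ 2))) ∧
    ∫ θ, r * Real.exp (-(n * I / 2 * (θ - a) ^ 2)) = r * √(2 * Real.pi) * (√n * √I)⁻¹ ∧
    ∫ θ in {θ | √n * (θ - a) * √I ≤ ξ}, r * Real.exp (-(n * I / 2 * (θ - a) ^ 2)) =
      cdf (gaussianReal 0 1) ξ * (r * √(2 * Real.pi) * (√n * √I)⁻¹) := by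
  have hs : 0 < √n * √I := mul_pos (Real.sqrt_pos.2 hn) (Real.sqrt_pos.2 hI)
  have hπ : 0 < √(2 * Real.pi) := Real.sqrt_pos.2 (by positivity)
  have hw : ∀ θ, r * Real.exp (-(n * I / 2 * (θ - a) ^ 2)) =
      r * √(2 * Real.pi) * gaussianPDFReal 0 1 (√n * √I * (θ - a)) := fun θ => by
    rw [gaussianPDFReal]
    have : (√n * √I * (θ - a)) ^ 2 = n * I * (θ - a) ^ 2 := by
      rw [mul_pow, mul_pow, Real.sq_sqrt hn.le, Real.sq_sqrt hI.le]
    simp only [sub_zero, NNReal.coe_one, mul_one, this]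
    field_simp
  have hint : Integrable (gaussianPDFReal 0 1) := integrable_gaussianPDFReal 0 1
  refine ⟨?_, ?_, ?_⟩
  · simp only [hw]
    have h1 := (hint.comp_mul_left' hs.ne').comp_sub_right a
    exact h1.const_mul _
  · simp only [hw]
    rw [integral_const_mul, integral_comp_mul_sub _ hs, integral_gaussianPDFReal_eq_one 0 one_ne_zero,
      mul_one]
  · have hS : {θ | √n * (θ - a) * √I ≤ ξ} = (fun θ => √n * √I * (θ - a)) ⁻¹' Iic ξ := by
      ext θ
      simp only [mem_ofPred_eq, mem_preimage, mem_Iic]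
      rw [mul_right_comm]
    have hmS : MeasurableSet {θ | √n * (θ - a) * √I ≤ ξ} :=
      measurableSet_le (by fun_prop) measurable_const
    simp only [hw]
    rw [integral_const_mul, ← integral_indicator hmS]
    have hind : ∀ θ, ({θ | √n * (θ - a) * √I ≤ ξ}).indicator
        (fun θ => gaussianPDFReal 0 1 (√n * √I * (θ - a))) θ =
        (Iic ξ).indicator (gaussianPDFReal 0 1) (√n * √I * (θ - a)) := fun θ => by
      rw [hS]; rfl
    simp only [hind]
    rw [integral_comp_mul_sub _ hs, integral_indicator measurableSet_Iic, cdf_eq_real,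
      measureReal_def, gaussianReal_apply_eq_integral _ one_ne_zero, ENNReal.toReal_ofReal]
    · ring
    · exact integral_nonneg fun y => gaussianPDFReal_nonneg _ _ _

/-- `N/Z - w/W = ((N - w) + (N/Z)(W - Z)) / W` with `N/Z ≤ 1`, so no lower bound on `Z` is needed.
When `Z = 0`, also `N = 0`, and the convention `0 / 0 = 0` is harmless. -/
theorem abs_div_sub_div_le {N Z w W D : ℝ} (hN : 0 ≤ N) (hNZ : N ≤ Z) (hW : 0 < W)
    (h₁ : |N - w| ≤ D) (h₂ : |Z - W| ≤ D) : |N / Z - w / W| ≤ 2 * D / W := by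
  have hD : 0 ≤ D := (abs_nonneg _).trans h₁
  rcases (hN.trans hNZ).eq_or_lt with h0 | h0
  · have : N = 0 := le_antisymm (h0 ▸ hNZ) hN
    subst this
    rw [zero_sub, abs_neg] at h₁
    rw [zero_div, zero_sub, abs_neg, abs_div, abs_of_pos hW]
    gcongr; linarith
  · have h3 : N / Z - w / W = ((N - w) + N / Z * (W - Z)) / W := by field_simp; ring
    have h4 : |N / Z| ≤ 1 := by
      rw [abs_of_nonneg (by positivity)]; exact div_le_one_of_le₀ hNZ h0.le
    rw [h3, abs_div, abs_of_pos hW]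
    gcongr
    refine (abs_add_le _ _).trans ?_
    rw [abs_mul, abs_sub_comm W Z]
    have : |N / Z| * |Z - W| ≤ 1 * D := mul_le_mul h4 h₂ (abs_nonneg _) zero_le_one
    linarith

/-- The difference is `exp(-I y²/2) ((v - r) e^R + r (e^R - 1))`. The factor `e^{|R|}` and the cubic
polynomial each use up `I y²/8` of the exponent, which leaves `exp(-I y²/4)`. -/
theorem abs_perturbed_gaussian_sub_le {I r v K B C δ h y R : ℝ} (hI : 0 < I) (hr : 0 < r)
    (hK : 0 ≤ K) (hB : 0 ≤ B) (hC : 0 ≤ C) (hCδ : C * (3 * δ) ≤ I / 16) (hh : 0 < h)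
    (hR : |R| ≤ C * (h * (1 + |y|) ^ 3)) (hy : h * (1 + |y|) ≤ 3 * δ)
    (hv : |v - r| ≤ K * ((1 + B) * (h * (1 + |y|) ^ 3))) :
    |v * Real.exp (-(I * y ^ 2 / 2) + R) - r * Real.exp (-(I * y ^ 2 / 2))| ≤
      h * ((K * (1 + B) + r * C) * Real.exp (I / 8 + 18 / I)) * Real.exp (-(I / 4) * y ^ 2) := by
  have hpow := one_add_abs_pow_three_le hI y
  -- One of the three factors `1 + |y|`, together with `h`, is traded for the small constant `3δ`,
  -- so that a quadratic bound remains.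
  have hR2 : |R| ≤ I / 8 + I * y ^ 2 / 8 := by
    refine hR.trans ?_
    have h1 : (1 + |y|) ^ 2 ≤ 2 + 2 * y ^ 2 := by
      rw [← sq_abs y]; nlinarith [sq_nonneg (|y| - 1)]
    calc C * (h * (1 + |y|) ^ 3) = C * (h * (1 + |y|)) * (1 + |y|) ^ 2 := by ring
      _ ≤ C * (3 * δ) * (1 + |y|) ^ 2 := by gcongr
      _ ≤ I / 16 * (2 + 2 * y ^ 2) := by gcongr
      _ = _ := by ring
  have hexpR : Real.exp |R| ≤ Real.exp (I / 8) * Real.exp (I * y ^ 2 / 8) := by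
    rw [← Real.exp_add]; exact Real.exp_le_exp.2 hR2
  have hexpR' : Real.exp R ≤ Real.exp |R| := Real.exp_le_exp.2 (le_abs_self R)
  have hcore : |(v - r) * Real.exp R + r * (Real.exp R - 1)| ≤
      (K * (1 + B) + r * C) * (h * (1 + |y|) ^ 3) *
        (Real.exp (I / 8) * Real.exp (I * y ^ 2 / 8)) := by
    refine (abs_add_le _ _).trans ?_
    rw [abs_mul, abs_mul, abs_of_pos (Real.exp_pos R), abs_of_pos hr]
    have h1 : |v - r| * Real.exp R ≤ K * ((1 + B) * (h * (1 + |y|) ^ 3)) * Real.exp |R| := by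
      gcongr
    have h2 : r * |Real.exp R - 1| ≤ r * (C * (h * (1 + |y|) ^ 3) * Real.exp |R|) := by
      gcongr
      refine (abs_exp_sub_one_le_mul_exp_abs R).trans ?_
      gcongr
    have h3 : |v - r| * Real.exp R + r * |Real.exp R - 1| ≤
        (K * (1 + B) + r * C) * (h * (1 + |y|) ^ 3) * Real.exp |R| := by
      refine (add_le_add h1 h2).trans_eq ?_
      ring
    refine h3.trans ?_
    gcongr
  have hfac : v * Real.exp (-(I * y ^ 2 / 2) + R) - r * Real.exp (-(I * y ^ 2 / 2)) =
      Real.exp (-(I * y ^ 2 / 2)) * ((v - r) * Real.exp R + r * (Real.exp R - 1)) := by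
    rw [Real.exp_add]; ring
  rw [hfac, abs_mul, abs_of_pos (Real.exp_pos _)]
  calc Real.exp (-(I * y ^ 2 / 2)) * |(v - r) * Real.exp R + r * (Real.exp R - 1)|
      ≤ Real.exp (-(I * y ^ 2 / 2)) * ((K * (1 + B) + r * C) *
        (h * (Real.exp (18 / I) * Real.exp (I * y ^ 2 / 8))) *
        (Real.exp (I / 8) * Real.exp (I * y ^ 2 / 8))) := by
        refine mul_le_mul_of_nonneg_left (hcore.trans ?_) (Real.exp_pos _).le
        gcongr
    _ = h * ((K * (1 + B) + r * C) * (Real.exp (I / 8) * Real.exp (18 / I))) *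
        (Real.exp (-(I * y ^ 2 / 2)) * Real.exp (I * y ^ 2 / 8) * Real.exp (I * y ^ 2 / 8)) := by
        ring
    _ = _ := by
        rw [← Real.exp_add, ← Real.exp_add, ← Real.exp_add]
        congr 2; ring

/-- At distance `δ` from `θ₀` the local parameter `|y|` is at least of order `1/h`; a factor `h` is
thus bought with a factor `|y|`, which the Gaussian absorbs. -/
theorem gaussian_tail_le {I r δ h y : ℝ} (hI : 0 < I) (hr : 0 < r) (hδ : 0 < δ) (hh : 0 < h)
    (hy : 1 ≤ h * (2 / δ * |y|)) :
    r * Real.exp (-(I * y ^ 2 / 2)) ≤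
      h * (2 * r / δ * Real.exp (18 / I)) * Real.exp (-(I / 4) * y ^ 2) := by
  have hy0 : 0 ≤ |y| := abs_nonneg y
  have hpow := one_add_abs_pow_three_le hI y
  have hy3 : |y| ≤ (1 + |y|) ^ 3 := by
    calc |y| ≤ (1 + |y|) ^ 1 := by rw [pow_one]; linarith
      _ ≤ (1 + |y|) ^ 3 := pow_le_pow_right₀ (by linarith) (by norm_num)
  have hE : Real.exp (I * y ^ 2 / 8) * Real.exp (-(I * y ^ 2 / 2)) ≤
      Real.exp (-(I / 4) * y ^ 2) := by
    rw [← Real.exp_add]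
    refine Real.exp_le_exp.2 ?_
    nlinarith [mul_nonneg hI.le (sq_nonneg y)]
  calc r * Real.exp (-(I * y ^ 2 / 2))
      = 1 * (r * Real.exp (-(I * y ^ 2 / 2))) := (one_mul _).symm
    _ ≤ h * (2 / δ * |y|) * (r * Real.exp (-(I * y ^ 2 / 2))) := by gcongr
    _ ≤ h * (2 / δ * (Real.exp (18 / I) * Real.exp (I * y ^ 2 / 8))) *
        (r * Real.exp (-(I * y ^ 2 / 2))) := by
        gcongr; exact hy3.trans hpow
    _ = h * (2 * r / δ * Real.exp (18 / I)) *
        (Real.exp (I * y ^ 2 / 8) * Real.exp (-(I * y ^ 2 / 2))) := by ring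
    _ ≤ h * (2 * r / δ * Real.exp (18 / I)) * Real.exp (-(I / 4) * y ^ 2) := by gcongr

/-- A density that is locally a perturbed Gaussian and exponentially small elsewhere is close to
the Gaussian in `L¹`. -/
theorem exists_integral_abs_sub_gaussian_le {θ₀ I r K B C c δ : ℝ} (hI : 0 < I) (hr : 0 < r)
    (hK : 0 ≤ K) (hB : 0 ≤ B) (hC : 0 ≤ C) (hc : 0 < c) (hδ : 0 < δ) (hCδ : C * (3 * δ) ≤ I / 16) :
    ∃ A : ℝ, 0 < A ∧ ∀ (n : ℝ) (Θ : Set ℝ) (a : ℝ) (ρ u : ℝ → ℝ), 0 < n → MeasurableSet Θ →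
      (√n)⁻¹ ≤ δ → |a - θ₀| ≤ B * (√n)⁻¹ → |a - θ₀| ≤ δ / 2 →
      (∀ θ, 0 ≤ ρ θ) → IntegrableOn ρ Θ → ∫ θ in Θ, ρ θ = 1 →
      (∀ θ ∈ Θ, 0 ≤ u θ) → IntegrableOn (fun θ => ρ θ * u θ) Θ →
      (∀ θ, |θ - θ₀| < δ → θ ∈ Θ ∧ |ρ θ - r| ≤ K * |θ - θ₀| ∧
        ∃ R, u θ = Real.exp (-(n * I / 2 * (θ - a) ^ 2) + R) ∧
          |R| ≤ n * (C * ((√n)⁻¹ + |θ - a|) ^ 3)) →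
      (∀ θ ∈ Θ, δ ≤ |θ - θ₀| → u θ ≤ Real.exp (-(n * c))) →
      ∫ θ, |Θ.indicator (fun θ => ρ θ * u θ) θ - r * Real.exp (-(n * I / 2 * (θ - a) ^ 2))| ≤
        A / n := by
  -- The constants of the near region and of the Gaussian tail, added to serve in both cases.
  set A₁ := (K * (1 + B) + r * C) * Real.exp (I / 8 + 18 / I) + 2 * r / δ * Real.exp (18 / I)
    with hA₁
  have hA₁0 : 0 < A₁ := by positivity
  have hgi : Integrable (fun y : ℝ => Real.exp (-(I / 4) * y ^ 2)) :=
    integrable_exp_neg_mul_sq (by positivity)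
  have hgi0 : 0 ≤ ∫ y : ℝ, Real.exp (-(I / 4) * y ^ 2) := integral_nonneg fun y => (Real.exp_pos _).le
  refine ⟨A₁ * (∫ y : ℝ, Real.exp (-(I / 4) * y ^ 2)) + 1 / c, by positivity, ?_⟩
  intro n Θ a ρ u hn hΘ hnδ haB haδ hρ0 hρi hρ1 hu0 hui hnear hfar
  have hs : 0 < √n := Real.sqrt_pos.2 hn
  have hss : √n * √n = n := Real.mul_self_sqrt hn.le
  set h := (√n)⁻¹ with hh
  have hh0 : 0 < h := inv_pos.2 hs
  have hsh : √n * h = 1 := mul_inv_cancel₀ hs.ne'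
  -- The Gaussian majorant carries one `h`, and the substitution `y = √n (θ - a)` yields another, in
  -- total `1/n`. In the far region `e^{-nc} ≤ 1/(nc)` is integrated against the prior, of mass one.
  have hbound : ∀ θ, |Θ.indicator (fun θ => ρ θ * u θ) θ -
      r * Real.exp (-(n * I / 2 * (θ - a) ^ 2))| ≤
      h * A₁ * Real.exp (-(I / 4) * (√n * (θ - a)) ^ 2) +
        Θ.indicator (fun θ => ρ θ * (1 / (n * c))) θ := by
    intro θ
    set y := √n * (θ - a) with hy
    have hy2 : n * (θ - a) ^ 2 = y ^ 2 := by rw [hy, mul_pow, Real.sq_sqrt hn.le]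
    have hexpo : -(n * I / 2 * (θ - a) ^ 2) = -(I * y ^ 2 / 2) := by rw [← hy2]; ring
    have hya : |θ - a| = h * |y| := by
      rw [hy, abs_mul, abs_of_pos hs, ← mul_assoc, mul_comm h, hsh, one_mul]
    have hy0 : 0 ≤ |y| := abs_nonneg y
    have hindnn : 0 ≤ Θ.indicator (fun θ => ρ θ * (1 / (n * c))) θ :=
      indicator_nonneg (fun θ _ => mul_nonneg (hρ0 θ) (by positivity)) θ
    rw [hexpo]
    by_cases hθ : |θ - θ₀| < δ
    · obtain ⟨hmem, hlip, R, hu, hR⟩ := hnear θ hθ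
      rw [indicator_of_mem hmem, hu, hexpo]
      have hsum : h + |θ - a| = h * (1 + |y|) := by rw [hya]; ring
      have hR1 : |R| ≤ C * (h * (1 + |y|) ^ 3) := by
        refine hR.trans_eq ?_
        rw [hsum, ← hss]
        calc √n * √n * (C * (h * (1 + |y|)) ^ 3)
            = (√n * h) * (√n * h) * (C * (h * (1 + |y|) ^ 3)) := by ring
          _ = _ := by rw [hsh]; ring
      have hsum2 : h * (1 + |y|) ≤ 3 * δ := by
        rw [← hsum]
        have h1 := abs_sub_le θ θ₀ a
        rw [abs_sub_comm θ₀ a] at h1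
        linarith
      have hρ : |ρ θ - r| ≤ K * ((1 + B) * (h * (1 + |y|) ^ 3)) := by
        refine hlip.trans (mul_le_mul_of_nonneg_left ?_ hK)
        have h1 := abs_sub_le θ a θ₀
        have h2 : (1 + |y|) ≤ (1 + |y|) ^ 3 := by
          have : 1 ≤ 1 + |y| := by linarith
          calc 1 + |y| = (1 + |y|) ^ 1 := (pow_one _).symm
            _ ≤ (1 + |y|) ^ 3 := pow_le_pow_right₀ this (by norm_num)
        calc |θ - θ₀| ≤ h * |y| + B * h := by linarith
          _ ≤ (1 + B) * (h * (1 + |y|)) := by nlinarith [mul_nonneg hB (mul_nonneg hh0.le hy0)]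
          _ ≤ (1 + B) * (h * (1 + |y|) ^ 3) := by gcongr
      have hmain := abs_perturbed_gaussian_sub_le hI hr hK hB hC hCδ hh0 hR1 hsum2 hρ
      refine hmain.trans (le_trans ?_ (le_add_of_nonneg_right hindnn))
      gcongr
      rw [hA₁]
      exact le_add_of_nonneg_right (by positivity)
    · have hθ' : δ ≤ |θ - θ₀| := not_lt.1 hθ
      have h1y : 1 ≤ h * (2 / δ * |y|) := by
        have h1 := abs_sub_le θ a θ₀
        have h2 : δ / 2 ≤ h * |y| := by rw [← hya]; linarith
        calc (1 : ℝ) = 2 / δ * (δ / 2) := by field_simp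
          _ ≤ 2 / δ * (h * |y|) := by gcongr
          _ = _ := by ring
      have hw : r * Real.exp (-(I * y ^ 2 / 2)) ≤ h * A₁ * Real.exp (-(I / 4) * y ^ 2) := by
        refine (gaussian_tail_le hI hr hδ hh0 h1y).trans ?_
        gcongr
        rw [hA₁]
        exact le_add_of_nonneg_left (by positivity)
      have hg0 : 0 ≤ Θ.indicator (fun θ => ρ θ * u θ) θ :=
        indicator_apply_nonneg fun hm => mul_nonneg (hρ0 θ) (hu0 θ hm)
      have hg1 : Θ.indicator (fun θ => ρ θ * u θ) θ ≤ Θ.indicator (fun θ => ρ θ * (1 / (n * c))) θ := by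
        by_cases hm : θ ∈ Θ
        · rw [indicator_of_mem hm, indicator_of_mem hm]
          refine mul_le_mul_of_nonneg_left ((hfar θ hm hθ').trans ?_) (hρ0 θ)
          rw [Real.exp_neg, one_div]
          refine inv_anti₀ (by positivity) ?_
          linarith [Real.add_one_le_exp (n * c)]
        · rw [indicator_of_notMem hm, indicator_of_notMem hm]
      have hw0 : 0 ≤ r * Real.exp (-(I * y ^ 2 / 2)) := by positivity
      refine (abs_sub _ _).trans ?_
      rw [abs_of_nonneg hg0, abs_of_nonneg hw0]
      linarith
  have hwint := (cdf_gaussianReal_eq_div (a := a) hn hI hr 0).1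
  have hgauss : Integrable (fun θ => h * A₁ * Real.exp (-(I / 4) * (√n * (θ - a)) ^ 2)) := by
    have h1 := (hgi.comp_mul_left' hs.ne').comp_sub_right a
    exact h1.const_mul _
  have hρint : Integrable (Θ.indicator (fun θ => ρ θ * (1 / (n * c)))) :=
    (integrable_indicator_iff hΘ).2 (hρi.mul_const _)
  refine (integral_mono (((integrable_indicator_iff hΘ).2 hui).sub hwint).abs
    (hgauss.add hρint) hbound).trans ?_
  simp only [Pi.add_apply]
  rw [integral_add hgauss hρint, integral_const_mul,
    integral_comp_mul_sub (fun y => Real.exp (-(I / 4) * y ^ 2)) hs, integral_indicator hΘ,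
    integral_mul_const, hρ1]
  refine le_of_eq ?_
  have hhn : h * h = 1 / n := by
    rw [hh, ← mul_inv, hss, one_div]
  calc h * A₁ * (h * ∫ y : ℝ, Real.exp (-(I / 4) * y ^ 2)) + 1 * (1 / (n * c))
      = (h * h) * (A₁ * ∫ y : ℝ, Real.exp (-(I / 4) * y ^ 2)) + 1 / (n * c) := by ring
    _ = _ := by rw [hhn]; field_simp

/-! ### The empirical score of the least favorable submodels. -/

theorem empMean_sub_integral {𝒳 : Type*} [MeasurableSpace 𝒳] (P : Measure 𝒳) {n : ℕ} (hn : 0 < n) (x : Fin n → 𝒳) (f : 𝒳 → ℝ) :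
    empMean n x f - ∫ y, f y ∂P = (√(n : ℝ))⁻¹ * empGn P n x f := by
  have hn0 : (0 : ℝ) < n := by exact_mod_cast hn
  have hs : (√(n : ℝ))⁻¹ * (√(n : ℝ))⁻¹ = (n : ℝ)⁻¹ := by
    rw [← mul_inv, Real.mul_self_sqrt hn0.le]
  rw [empGn, ← mul_assoc, hs, empMean, Finset.sum_sub_distrib, mul_sub]
  simp only [Finset.sum_const, Finset.card_univ, Fintype.card_fin, nsmul_eq_mul]
  field_simp

theorem empMean_sub {𝒳 : Type*} (n : ℕ) (x : Fin n → 𝒳) (f g : 𝒳 → ℝ) :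
    empMean n x (fun y => f y - g y) = empMean n x f - empMean n x g := by
  simp only [empMean, Finset.sum_sub_distrib, mul_sub]

theorem hasDerivAt_empMean {𝒳 : Type*} {n : ℕ} {x : Fin n → 𝒳} {f f' : ℝ → 𝒳 → ℝ} {t : ℝ}
    (h : ∀ i, HasDerivAt (fun s => f s (x i)) (f' t (x i)) t) :
    HasDerivAt (fun s => empMean n x (f s)) (empMean n x (f' t)) t :=
  (HasDerivAt.fun_sum fun i _ => h i).const_mul _

theorem abs_empMean_le {𝒳 : Type*} {n : ℕ} {x : Fin n → 𝒳} {f F : 𝒳 → ℝ} (h : ∀ i, |f (x i)| ≤ F (x i)) :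
    |empMean n x f| ≤ empMean n x F := by
  rw [empMean, empMean, abs_mul, abs_of_nonneg (by positivity : (0 : ℝ) ≤ (n : ℝ)⁻¹)]
  exact mul_le_mul_of_nonneg_left
    ((Finset.abs_sum_le_sum_abs _ _).trans (Finset.sum_le_sum fun i _ => h i)) (by positivity)

theorem tendsto_inv_sqrt_atTop : Tendsto (fun n : ℕ => (√(n : ℝ))⁻¹) atTop (𝓝 0) :=
  tendsto_inv_atTop_zero.comp (Real.tendsto_sqrt_atTop.comp tendsto_natCast_atTop_atTop)

namespace SemiparametricModel

variable {𝒳 : Type*} [MeasurableSpace 𝒳] {E : Type*} [NormedAddCommGroup E]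
  {M : SemiparametricModel 𝒳 E} {θ₀ : ℝ} {η₀ : E} {D : Set (ℝ → E)} {sub : ℝ → ℝ → E → E}
  {ηhat : (n : ℕ) → (Fin n → 𝒳) → ℝ → E}

namespace StandingAssumptions

/-- The linear expansion of the empirical score of the least favorable submodels through the
profile maximisers. -/
theorem exists_score_expansion (hM : M.StandingAssumptions θ₀ η₀ D sub ηhat) {ε₀ ε : ℝ}
    (hε₀ : 0 < ε₀) (hΘ : ∀ t, |t - θ₀| < ε₀ → t ∈ M.Θ)
    (hH : ∀ t θ η, |t - θ₀| < ε₀ → |θ - θ₀| < ε₀ → η ∈ M.H → ‖η - η₀‖ < ε₀ → sub t θ η ∈ M.H)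
    {F : 𝒳 → ℝ} (hF : Integrable F (M.P θ₀ η₀))
    (hreg : ∀ᵐ x ∂M.P θ₀ η₀, RegularAt M sub θ₀ η₀ ε₀ (F x) x) (hε : 0 < ε) :
    ∃ C δ : ℝ, 0 < C ∧ 0 < δ ∧ δ ≤ ε₀ ∧ HoldsUpTo (M.P θ₀ η₀) (5 * ε) fun n x =>
      ∀ θ, |θ - θ₀| < δ → ‖ηhat n x θ - η₀‖ < ε₀ ∧
        ∀ t, |t - θ₀| < δ →
          |empMean n x (M.ell sub 1 0 t θ (ηhat n x θ)) - empMean n x (M.ell sub 1 0 θ₀ θ₀ η₀) +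
            M.efficientInfo θ₀ η₀ D * (t - θ₀)| ≤
            C * ((√(n : ℝ))⁻¹ + |θ - θ₀| + |t - θ₀|) ^ 2 := by
  have := hM.isProbabilityMeasure
  obtain ⟨hP1, hP2, hP3⟩ := hM.integral_ell
  have h00 : |θ₀ - θ₀| < ε₀ := by simpa
  have hη00 : ‖η₀ - η₀‖ < ε₀ := by simpa
  have hF0 : 0 ≤ᵐ[M.P θ₀ η₀] F := by
    filter_upwards [hreg] with x hx
    exact (abs_nonneg _).trans (hx.bound (1, 0) (by simp [orders]) θ₀ θ₀ η₀ h00 h00 hM.mem_H hη00)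
  obtain ⟨K₁, hK₁, w₁⟩ := exists_empMean_le hF hF0 hε
  obtain ⟨εc, hεc, hD2, hD1, -⟩ := hM.classes
  obtain ⟨K₂, hK₂, w₂⟩ := hD2.exists_bound hε
  obtain ⟨K₃, hK₃, w₃⟩ := hD1.exists_bound hε
  obtain ⟨εm, hεm, hmod⟩ := hM.modulus
  obtain ⟨K₄, hK₄, hmod⟩ := hmod ε hε
  have w₄ : HoldsUpTo (M.P θ₀ η₀) ε fun n x => ∀ η ∈ M.H, ‖η - η₀‖ < εm →
      |empGn (M.P θ₀ η₀) n x fun y =>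
        M.ell sub 1 0 θ₀ θ₀ η y - M.ell sub 1 0 θ₀ θ₀ η₀ y| ≤ K₄ * ‖η - η₀‖ := by
    filter_upwards [hmod] with n hn
    refine (measure_mono fun x hx => ?_).trans hn
    simp only [mem_ofPred_eq] at hx ⊢
    push Not at hx
    exact hx
  obtain ⟨K₅, δ₅, hK₅, hδ₅, w₅⟩ := exists_uniform_rate hM.mem_Θ hM.rate hε
  obtain ⟨ε₆, hε₆, K₆, h₆⟩ := hM.smooth_tt
  obtain ⟨ε₇, hε₇, K₇, h₇⟩ := hM.smooth_tθ
  obtain ⟨ε₈, hε₈, K₈, h₈⟩ := hM.no_bias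
  -- One constant for all bounds, at least `1` as `abs_score_expansion_le` requires. The five `ε`
  -- are spent on the envelope mean, the two Donsker classes, the modulus and the rate.
  obtain ⟨K, hKs⟩ : ∃ K, ∀ k ∈ [1, K₁, K₂, K₃, K₄, K₅, K₆, K₇, K₈], k ≤ K :=
    ⟨1 + |K₁| + |K₂| + |K₃| + |K₄| + |K₅| + |K₆| + |K₇| + |K₈|, by
      simp only [List.mem_cons, List.not_mem_nil, or_false, forall_eq_or_imp, forall_eq]
      refine ⟨?_, ?_, ?_, ?_, ?_, ?_, ?_, ?_, ?_⟩ <;>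
      linarith [abs_nonneg K₁, abs_nonneg K₂, abs_nonneg K₃, abs_nonneg K₄, abs_nonneg K₅,
        abs_nonneg K₆, abs_nonneg K₇, abs_nonneg K₈, le_abs_self K₁, le_abs_self K₂,
        le_abs_self K₃, le_abs_self K₄, le_abs_self K₅, le_abs_self K₆, le_abs_self K₇,
        le_abs_self K₈]⟩
  simp only [List.mem_cons, List.not_mem_nil, or_false, forall_eq_or_imp, forall_eq] at hKs
  obtain ⟨hK, hk₁, hk₂, hk₃, hk₄, hk₅, hk₆, hk₇, hk₈⟩ := hKs
  obtain ⟨ε₁, hε₁, hεs⟩ : ∃ ε₁ > 0, ∀ e ∈ [ε₀, εc, εm, ε₆, ε₇, ε₈], ε₁ ≤ e := by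
    refine ⟨min ε₀ (min εc (min εm (min ε₆ (min ε₇ ε₈)))), by positivity, ?_⟩
    simp
  simp only [List.mem_cons, List.not_mem_nil, or_false, forall_eq_or_imp, forall_eq] at hεs
  obtain ⟨he₀, hec, hem, he₆, he₇, he₈⟩ := hεs
  have hK0 : 0 < K := by linarith
  -- With `h` and `|θ - θ₀|` below `ε₁ / (2K)`, the rate forces `‖η̂_θ - η₀‖ < ε₁`, inside every
  -- neighbourhood in use.
  set δ := min ε₀ (min δ₅ (ε₁ / (2 * K))) with hδdef
  have hδ : 0 < δ := by positivity
  refine ⟨9 * K ^ 3, δ, by positivity, hδ, min_le_left _ _, ?_⟩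
  have hall := (((w₁.and hε.le hε.le w₂).and (by positivity) hε.le w₃).and
    (by positivity) hε.le w₄).and (by positivity) hε.le w₅
  have hall' := hall.and_ae (Eventually.of_forall fun n => ae_sampleLaw_forall hreg n)
  have hall'' := hall'.and_ae (hM.ηhat_max)
  have : 5 * ε = ε + ε + ε + ε + ε := by ring
  rw [this]
  refine hall''.mono ?_
  filter_upwards [eventually_ge_atTop 1, (tendsto_order.1 tendsto_inv_sqrt_atTop).2
    (ε₁ / (2 * K)) (by positivity)] with n hn hnh
  rintro x ⟨⟨⟨⟨⟨⟨m₁, m₂⟩, m₃⟩, m₄⟩, m₅⟩, hx⟩, hmax⟩ θ hθ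
  have hθ₀ : |θ - θ₀| < ε₀ := hθ.trans_le (min_le_left _ _)
  have hθ₅ : |θ - θ₀| < δ₅ := hθ.trans_le ((min_le_right _ _).trans (min_le_left _ _))
  have hθ₁ : |θ - θ₀| < ε₁ / (2 * K) := hθ.trans_le ((min_le_right _ _).trans (min_le_right _ _))
  have hηH := (hmax θ (hΘ θ hθ₀)).1
  set η := ηhat n x θ with hη
  set h := (√(n : ℝ))⁻¹ with hh
  have hh0 : 0 ≤ h := by positivity
  have heK : ‖η - η₀‖ ≤ K * (h + |θ - θ₀|) :=
    (m₅ θ (hΘ θ hθ₀) hθ₅).trans (mul_le_mul_of_nonneg_right hk₅ (by positivity))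
  have heε : ‖η - η₀‖ < ε₁ := by
    refine heK.trans_lt ?_
    calc K * (h + |θ - θ₀|) < K * (ε₁ / (2 * K) + ε₁ / (2 * K)) := by gcongr
      _ = ε₁ := by field_simp; ring
  have heη₀ : ‖η - η₀‖ < ε₀ := heε.trans_le he₀
  refine ⟨heη₀, fun t ht => ?_⟩
  have ht₀ : |t - θ₀| < ε₀ := ht.trans_le (min_le_left _ _)
  have hb : ∀ o ∈ orders, ∀ t θ, |t - θ₀| < ε₀ → |θ - θ₀| < ε₀ →
      |empMean n x (M.ell sub o.1 o.2 t θ η)| ≤ K := fun o ho t θ ht hθ =>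
    (abs_empMean_le fun i => (hx i).bound o ho t θ η ht hθ hηH heη₀).trans (m₁.trans hk₁)
  have he0 : 0 ≤ ‖η - η₀‖ := norm_nonneg _
  have hnb : (θ₀, θ₀, η) ∈ M.nbhd θ₀ η₀ εc :=
    ⟨hM.mem_Θ, by simpa, hM.mem_Θ, by simpa, hηH, heε.trans_le hec⟩
  refine abs_score_expansion_le (a₁₀ := fun t θ => empMean n x (M.ell sub 1 0 t θ η))
    (a₂₀ := fun t θ => empMean n x (M.ell sub 2 0 t θ η))
    (a₃₀ := fun t θ => empMean n x (M.ell sub 3 0 t θ η))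
    (a₁₁ := fun t θ => empMean n x (M.ell sub 1 1 t θ η))
    (a₁₂ := fun t θ => empMean n x (M.ell sub 1 2 t θ η))
    (a₂₁ := fun t θ => empMean n x (M.ell sub 2 1 t θ η)) (ε := ε₀) (e := ‖η - η₀‖)
    hε₀ hK hh0 he0 ?_ ?_ ?_ ?_ ?_ ?_ ?_ ?_ ?_ ?_ ?_ hθ₀ heK ht₀
  · exact fun t θ ht hθ => hasDerivAt_empMean
      (f := fun s => M.ell sub 1 0 s θ η) (f' := fun s => M.ell sub 2 0 s θ η) fun i =>
      (hx i).left 1 (by norm_num) t θ η ht hθ hηH heη₀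
  · exact fun t θ ht hθ => hasDerivAt_empMean
      (f := fun s => M.ell sub 2 0 s θ η) (f' := fun s => M.ell sub 3 0 s θ η) fun i =>
      (hx i).left 2 (by norm_num) t θ η ht hθ hηH heη₀
  · exact fun θ hθ => hasDerivAt_empMean
      (f := fun s => M.ell sub 1 0 θ₀ s η) (f' := fun s => M.ell sub 1 1 θ₀ s η) fun i =>
      (hx i).right 1 0 (by simp) θ₀ θ η h00 hθ hηH heη₀
  · exact fun θ hθ => hasDerivAt_empMean
      (f := fun s => M.ell sub 1 1 θ₀ s η) (f' := fun s => M.ell sub 1 2 θ₀ s η) fun i =>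
      (hx i).right 1 1 (by simp) θ₀ θ η h00 hθ hηH heη₀
  · exact fun θ hθ => hasDerivAt_empMean
      (f := fun s => M.ell sub 2 0 θ₀ s η) (f' := fun s => M.ell sub 2 1 θ₀ s η) fun i =>
      (hx i).right 2 0 (by simp) θ₀ θ η h00 hθ hηH heη₀
  · exact fun t θ ht hθ => hb (3, 0) (by simp [orders]) t θ ht hθ
  · exact fun θ hθ => hb (1, 2) (by simp [orders]) θ₀ θ h00 hθ
  · exact fun θ hθ => hb (2, 1) (by simp [orders]) θ₀ θ h00 hθ
  · have hi := integrable_ell_one hΘ hH hF hreg h00 h00 hηH heη₀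
    have hi₀ := integrable_ell_one hΘ hH hF hreg h00 h00 hM.mem_H hη00
    have h1 := empMean_sub_integral (M.P θ₀ η₀) hn x
      (fun y => M.ell sub 1 0 θ₀ θ₀ η y - M.ell sub 1 0 θ₀ θ₀ η₀ y)
    rw [empMean_sub, integral_sub hi hi₀, hP1, sub_zero] at h1
    have h2 := m₄ η hηH (heε.trans_le hem)
    have h3 := h₈ η hηH (heε.trans_le he₈)
    -- Fluctuation plus bias: the modulus condition bounds the first by `h ‖η - η₀‖`, the no-bias
    -- condition the second by `‖η - η₀‖²`, up to constants. For the second derivatives below, the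
    -- Donsker bound and Lipschitz means play these roles.
    have h4 : empMean n x (M.ell sub 1 0 θ₀ θ₀ η) - empMean n x (M.ell sub 1 0 θ₀ θ₀ η₀) =
        h * (empGn (M.P θ₀ η₀) n x fun y =>
          M.ell sub 1 0 θ₀ θ₀ η y - M.ell sub 1 0 θ₀ θ₀ η₀ y) +
        ∫ y, M.ell sub 1 0 θ₀ θ₀ η y ∂M.P θ₀ η₀ := by linarith
    rw [h4]
    refine (abs_add_le _ _).trans ?_
    rw [abs_mul, abs_of_nonneg hh0, mul_add]
    refine add_le_add ?_ (h3.trans (by gcongr))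
    calc h * _ ≤ h * (K * ‖η - η₀‖) := by gcongr; exact h2.trans (by gcongr)
      _ = K * (h * ‖η - η₀‖) := by ring
  · have h1 := empMean_sub_integral (M.P θ₀ η₀) hn x (M.ell sub 1 1 θ₀ θ₀ η)
    have h2 := m₃ _ ⟨_, hnb, rfl⟩
    have h3 := h₇ η hηH (heε.trans_le he₇)
    rw [hP3, sub_zero] at h3
    have h4 : empMean n x (M.ell sub 1 1 θ₀ θ₀ η) =
      h * empGn (M.P θ₀ η₀) n x (M.ell sub 1 1 θ₀ θ₀ η) +
        ∫ y, M.ell sub 1 1 θ₀ θ₀ η y ∂M.P θ₀ η₀ := by linarith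
    rw [h4]
    refine (abs_add_le _ _).trans ?_
    rw [abs_mul, abs_of_nonneg hh0, mul_add, mul_comm K h]
    exact add_le_add (by gcongr; exact h2.trans hk₃) (h3.trans (by gcongr))
  · have h1 := empMean_sub_integral (M.P θ₀ η₀) hn x (M.ell sub 2 0 θ₀ θ₀ η)
    have h2 := m₂ _ ⟨_, hnb, rfl⟩
    have h3 := h₆ η hηH (heε.trans_le he₆)
    rw [hP2, sub_neg_eq_add] at h3
    have h4 : empMean n x (M.ell sub 2 0 θ₀ θ₀ η) + M.efficientInfo θ₀ η₀ D =
      h * empGn (M.P θ₀ η₀) n x (M.ell sub 2 0 θ₀ θ₀ η) +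
        (∫ y, M.ell sub 2 0 θ₀ θ₀ η y ∂M.P θ₀ η₀ + M.efficientInfo θ₀ η₀ D) := by linarith
    rw [h4]
    refine (abs_add_le _ _).trans ?_
    rw [abs_mul, abs_of_nonneg hh0, mul_add, mul_comm K h]
    exact add_le_add (by gcongr; exact h2.trans hk₂) (h3.trans (by gcongr))

/-! ### The profile likelihood away from the truth: consistency and exponential gap. -/

theorem profileLik_eq {n : ℕ} {x : Fin n → 𝒳}
    (hmax : ∀ θ ∈ M.Θ, ηhat n x θ ∈ M.H ∧ ∀ η ∈ M.H, M.lik n x θ η ≤ M.lik n x θ (ηhat n x θ))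
    {θ : ℝ} (hθ : θ ∈ M.Θ) : M.profileLik n x θ = M.lik n x θ (ηhat n x θ) := by
  refine le_antisymm (iSup₂_le fun η hη => ?_) ?_
  · exact_mod_cast (hmax θ hθ).2 η hη
  · exact le_iSup₂_of_le (ηhat n x θ) (hmax θ hθ).1 le_rfl

theorem ae_profileLik_pos (hM : M.StandingAssumptions θ₀ η₀ D sub ηhat) (n : ℕ) :
    ∀ᵐ x ∂sampleLaw (M.P θ₀ η₀) n, 0 < M.profileLik n x θ₀ := by
  have := hM.isProbabilityMeasure
  obtain ⟨ε, hε, F, -, h⟩ := hM.envelope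
  have hpos : ∀ᵐ x ∂M.P θ₀ η₀, 0 < M.p θ₀ η₀ x := by
    filter_upwards [h] with x hx
    have h1 := (hx (θ₀, θ₀, η₀)
      ⟨hM.mem_Θ, by simpa, hM.mem_Θ, by simpa, hM.mem_H, by simpa⟩).1
    simpa only [hM.sub_diag θ₀ hM.mem_Θ η₀ hM.mem_H] using h1
  filter_upwards [ae_sampleLaw_forall hpos n] with x hx
  refine lt_of_lt_of_le ?_ (le_iSup₂_of_le η₀ hM.mem_H le_rfl)
  rw [ENNReal.coe_pos, lik]
  exact Finset.prod_pos fun i _ => hx i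

/-- Both profile likelihoods are finite and positive here, so the extended-real difference of
logarithms is a real number in `[-c, 0]`. -/
theorem profileDelta_abs_le {n : ℕ} (hn : 0 < n) {x : Fin n → 𝒳} {a θ c : ℝ}
    (ha : M.profileLik n x a ≠ ∞) (hle : M.profileLik n x θ ≤ M.profileLik n x a)
    (hlt : ENNReal.ofReal (Real.exp (-(n * c))) * M.profileLik n x a < M.profileLik n x θ) :
    (M.profileDelta n x a θ).abs ≤ ENNReal.ofReal c := by
  have hn0 : (0 : ℝ) < n := by exact_mod_cast hn
  have hθ : M.profileLik n x θ ≠ ∞ := ne_top_of_le_ne_top ha hle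
  obtain ⟨A, hA⟩ : ∃ A : ℝ≥0, (A : ℝ≥0∞) = M.profileLik n x a := ⟨_, ENNReal.coe_toNNReal ha⟩
  obtain ⟨B, hB⟩ : ∃ B : ℝ≥0, (B : ℝ≥0∞) = M.profileLik n x θ := ⟨_, ENNReal.coe_toNNReal hθ⟩
  rw [← hA, ← hB] at hle hlt
  have hBA : (B : ℝ) ≤ A := by exact_mod_cast hle
  have hB0 : (0 : ℝ) < B := by
    have : (0 : ℝ≥0∞) < B := lt_of_le_of_lt (zero_le) hlt
    exact_mod_cast this
  have hA0 : (0 : ℝ) < A := hB0.trans_le hBA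
  have hlt' : Real.exp (-(n * c)) * A < B := by
    rw [← ENNReal.ofReal_coe_nnreal (p := A), ← ENNReal.ofReal_coe_nnreal (p := B),
      ← ENNReal.ofReal_mul (Real.exp_pos _).le] at hlt
    exact (ENNReal.ofReal_lt_ofReal_iff hB0).1 hlt
  have hlog : ∀ C : ℝ≥0, (0 : ℝ) < C → ENNReal.log C = (Real.log C : EReal) := fun C hC => by
    rw [← ENNReal.ofReal_coe_nnreal, ENNReal.log_ofReal_of_pos hC]
  have h1 : Real.log B ≤ Real.log A := Real.log_le_log hB0 hBA
  have h2 : -(n * c) + Real.log A ≤ Real.log B := by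
    rw [← Real.log_exp (-(n * c)), ← Real.log_mul (Real.exp_pos _).ne' hA0.ne']
    exact Real.log_le_log (by positivity) hlt'.le
  have h3 : M.profileDelta n x a θ = (((Real.log B - Real.log A) / n : ℝ) : EReal) := by
    rw [profileDelta, ← hA, ← hB, hlog A hA0, hlog B hB0]
    rfl
  rw [h3, EReal.abs_def]
  refine ENNReal.ofReal_le_ofReal ?_
  rw [abs_div, abs_of_pos hn0, div_le_iff₀ hn0, abs_le]
  constructor <;> nlinarith

section Identifiability

variable {θhat : (n : ℕ) → (Fin n → 𝒳) → ℝ}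

/-- `Δ_n(θ̂) = 0`, so identifiability applied to `θ̂` is consistency. If no gap `c` worked,
parameters at distance at least `δ` with `Δ_n > -1/(k+1)` would form a sequence with `Δ_n = o_P(1)`
that is not consistent. -/
theorem exists_identifiability_gap (hM : M.StandingAssumptions θ₀ η₀ D sub ηhat)
    (hθhat : ∀ᶠ n in atTop, ∀ᵐ x ∂sampleLaw (M.P θ₀ η₀) n, θhat n x ∈ M.Θ ∧
      ∀ θ ∈ M.Θ, M.profileLik n x θ ≤ M.profileLik n x (θhat n x))
    (hident : ∀ θt : (n : ℕ) → (Fin n → 𝒳) → ℝ, (∀ n x, θt n x ∈ M.Θ) →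
      IsLittleOP (M.P θ₀ η₀) (fun n x => (M.profileDelta n x (θhat n x) (θt n x)).abs) →
      IsLittleOP (M.P θ₀ η₀) fun n x => ENNReal.ofReal |θt n x - θ₀|)
    {δ ε : ℝ} (hδ : 0 < δ) (hε : 0 < ε) :
    (HoldsUpTo (M.P θ₀ η₀) ε fun n x => |θhat n x - θ₀| < δ) ∧
    ∃ c : ℝ, 0 < c ∧ HoldsUpTo (M.P θ₀ η₀) ε fun n x => ∀ θ ∈ M.Θ, δ ≤ |θ - θ₀| →
      M.profileLik n x θ ≤ ENNReal.ofReal (Real.exp (-(n * c))) * M.profileLik n x (θhat n x) := by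
  classical
  have := hM.isProbabilityMeasure
  -- Identifiability concerns sequences lying in `M.Θ` for every sample, whereas `θhat` does so only
  -- almost surely.
  let d : (n : ℕ) → (Fin n → 𝒳) → ℝ := fun n x => if θhat n x ∈ M.Θ then θhat n x else θ₀
  have hd : ∀ n x, d n x ∈ M.Θ := fun n x => by
    by_cases h : θhat n x ∈ M.Θ
    · simp only [d, if_pos h]; exact h
    · simp only [d, if_neg h]; exact hM.mem_Θ
  have hdeq : ∀ {n x}, θhat n x ∈ M.Θ → d n x = θhat n x := fun h => by simp only [d, if_pos h]
  have hgood : ∀ᶠ n in atTop, ∀ᵐ x ∂sampleLaw (M.P θ₀ η₀) n, θhat n x ∈ M.Θ ∧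
      (∀ θ ∈ M.Θ, M.profileLik n x θ ≤ M.profileLik n x (θhat n x)) ∧
      M.profileLik n x (θhat n x) ≠ ∞ ∧ 0 < M.profileLik n x (θhat n x) := by
    filter_upwards [hθhat, hM.ηhat_max] with n h1 h2
    filter_upwards [h1, h2, hM.ae_profileLik_pos n] with x hx1 hx2 hx3
    refine ⟨hx1.1, hx1.2, ?_, hx3.trans_le (hx1.2 θ₀ hM.mem_Θ)⟩
    rw [profileLik_eq hx2 hx1.1]
    exact ENNReal.coe_ne_top
  have hself : ∀ n x, M.profileLik n x (θhat n x) ≠ ∞ → 0 < M.profileLik n x (θhat n x) →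
      (M.profileDelta n x (θhat n x) (θhat n x)).abs = 0 := by
    intro n x h1 h2
    rw [profileDelta, EReal.sub_self, EReal.zero_div, EReal.abs_zero]
    · simpa using h1
    · simpa using h2.ne'
  constructor
  · have hl := hident d hd (fun ε' hε' => ?_)
    · have h1 := (tendsto_order.1 (hl (δ / 2) (by positivity))).2 (ENNReal.ofReal ε) (by simpa)
      filter_upwards [h1, hgood] with n hn hn'
      refine (measure_mono_ae ?_).trans hn.le
      filter_upwards [hn'] with x hx hx'
      change ¬ |θhat n x - θ₀| < δ at hx'
      change ENNReal.ofReal (δ / 2) < ENNReal.ofReal |d n x - θ₀|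
      rw [hdeq hx.1]
      rw [ENNReal.ofReal_lt_ofReal_iff] <;> linarith
    · refine tendsto_const_nhds.congr' ?_
      filter_upwards [hgood] with n hn
      symm
      rw [measure_eq_zero_iff_ae_notMem]
      filter_upwards [hn] with x hx hx'
      change ENNReal.ofReal ε' < (M.profileDelta n x (θhat n x) (d n x)).abs at hx'
      rw [hdeq hx.1, hself n x hx.2.2.1 hx.2.2.2] at hx'
      exact not_lt_zero hx'
  · by_contra hcon
    push Not at hcon
    let B : ℕ → (n : ℕ) → (Fin n → 𝒳) → ℝ → Prop := fun k n x θ => δ ≤ |θ - θ₀| ∧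
      ENNReal.ofReal (Real.exp (-(n * (1 / ((k : ℝ) + 1))))) * M.profileLik n x (θhat n x) <
        M.profileLik n x θ
    have hB : ∀ k, ∃ᶠ n in atTop, ENNReal.ofReal ε <
        sampleLaw (M.P θ₀ η₀) n {x | ∃ θ ∈ M.Θ, B k n x θ} := by
      intro k
      have h := hcon (1 / ((k : ℝ) + 1)) (by positivity)
      rw [HoldsUpTo, not_eventually] at h
      refine h.mono fun n hn => ?_
      rw [not_le] at hn
      refine hn.trans_le (measure_mono fun x hx => ?_)
      simp only [mem_ofPred_eq] at hx ⊢
      push Not at hx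
      exact hx
    obtain ⟨φ, θt, hφ, hmem, hor, hbig⟩ := exists_exceptional_sequence _ B hB d hd
    have hl := hident θt hmem (fun ε' hε' => ?_)
    · have h1 := (tendsto_order.1 (hl (δ / 2) (by positivity))).2 (ENNReal.ofReal ε) (by simpa)
      obtain ⟨k, hk⟩ := (hφ.tendsto_atTop.eventually h1).exists
      refine absurd (hbig k) (not_lt.2 (le_trans (measure_mono fun x hx => ?_) hk.le))
      have hx1 : δ ≤ |θt (φ k) x - θ₀| := hx.1
      change ENNReal.ofReal (δ / 2) < ENNReal.ofReal |θt (φ k) x - θ₀|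
      rw [ENNReal.ofReal_lt_ofReal_iff] <;> linarith
    · obtain ⟨k₀, hk₀⟩ := exists_nat_one_div_lt hε'
      refine tendsto_const_nhds.congr' ?_
      filter_upwards [hgood, eventually_ge_atTop (φ k₀), eventually_ge_atTop 1] with n hn hn1 hn2
      symm
      rw [measure_eq_zero_iff_ae_notMem]
      filter_upwards [hn] with x hx hx'
      change ENNReal.ofReal ε' < (M.profileDelta n x (θhat n x) (θt n x)).abs at hx'
      rcases hor n x with h | ⟨k, hk, -, hlt⟩
      · rw [h, hdeq hx.1, hself n x hx.2.2.1 hx.2.2.2] at hx'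
        exact not_lt_zero hx'
      · refine absurd hx' (not_lt.2 ?_)
        refine (profileDelta_abs_le hn2 hx.2.2.1 (hx.2.1 _ (hmem n x)) hlt).trans
          (ENNReal.ofReal_le_ofReal ?_)
        have hkk : k₀ ≤ k := hφ.le_iff_le.1 (hk ▸ hn1)
        have : 1 / ((k : ℝ) + 1) ≤ 1 / ((k₀ : ℝ) + 1) := by
          apply one_div_le_one_div_of_le (by positivity)
          have : (k₀ : ℝ) ≤ k := by exact_mod_cast hkk
          linarith
        linarith

end Identifiability

end StandingAssumptions

end SemiparametricModel

/-! ### From the `L¹` bound to the posterior profile distribution. -/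

namespace SemiparametricModel

variable {𝒳 : Type*} [MeasurableSpace 𝒳] {E : Type*} [NormedAddCommGroup E]
  {M : SemiparametricModel 𝒳 E}

/-- Normalisation cancels `L`, which allows `pl_n` to be divided by its maximum. -/
theorem posteriorProfile_real {ρ : ℝ → ℝ≥0} {n : ℕ} {x : Fin n → 𝒳} {g : ℝ → ℝ} {L : ℝ≥0∞}
    (hΘ : MeasurableSet M.Θ) (hL : L ≠ 0) (hL' : L ≠ ∞)
    (hg : ∀ θ ∈ M.Θ, ρ θ * M.profileLik n x θ = L * ENNReal.ofReal (g θ))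
    (hg0 : ∀ θ ∈ M.Θ, 0 ≤ g θ) (hgi : IntegrableOn g M.Θ) {S : Set ℝ} (hS : MeasurableSet S) :
    (M.posteriorProfile ρ n x).real S = (∫ θ in S ∩ M.Θ, g θ) / ∫ θ in M.Θ, g θ := by
  have key : ∀ T : Set ℝ, MeasurableSet T → T ⊆ M.Θ →
      ∫⁻ θ in T, ρ θ * M.profileLik n x θ = L * ENNReal.ofReal (∫ θ in T, g θ) := by
    intro T hT hTΘ
    rw [ofReal_integral_eq_lintegral_ofReal (hgi.mono_set hTΘ)
      ((ae_restrict_iff' hT).2 (ae_of_all _ fun θ hθ => hg0 θ (hTΘ hθ))),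
      ← lintegral_const_mul' _ _ hL']
    exact setLIntegral_congr_fun hT fun θ hθ => hg θ (hTΘ hθ)
  have hnum : 0 ≤ ∫ θ in S ∩ M.Θ, g θ :=
    setIntegral_nonneg (hS.inter hΘ) fun θ hθ => hg0 θ hθ.2
  have hden : 0 ≤ ∫ θ in M.Θ, g θ := setIntegral_nonneg hΘ hg0
  rw [measureReal_def, posteriorProfile, Measure.smul_apply, withDensity_apply _ hS,
    Measure.restrict_restrict hS, key M.Θ hΘ subset_rfl, key _ (hS.inter hΘ) inter_subset_right,
    smul_eq_mul, ENNReal.toReal_mul, ENNReal.toReal_inv, ENNReal.toReal_mul, ENNReal.toReal_mul,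
    ENNReal.toReal_ofReal hnum, ENNReal.toReal_ofReal hden]
  have hLr : L.toReal ≠ 0 := ENNReal.toReal_ne_zero.2 ⟨hL, hL'⟩
  rw [mul_inv, div_eq_mul_inv]
  field_simp

theorem abs_posteriorProfile_sub_cdf_le {ρ : ℝ → ℝ≥0} {n : ℕ} {x : Fin n → 𝒳} {g : ℝ → ℝ}
    {L : ℝ≥0∞} {r I a A : ℝ} (hn : 0 < n) (hr : 0 < r) (hI : 0 < I)
    (hΘ : MeasurableSet M.Θ) (hL : L ≠ 0) (hL' : L ≠ ∞)
    (hg : ∀ θ ∈ M.Θ, ρ θ * M.profileLik n x θ = L * ENNReal.ofReal (g θ))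
    (hg0 : ∀ θ ∈ M.Θ, 0 ≤ g θ) (hgi : IntegrableOn g M.Θ)
    (hA : ∫ θ, |M.Θ.indicator g θ - r * Real.exp (-(n * I / 2 * (θ - a) ^ 2))| ≤ A / n) (ξ : ℝ) :
    |(M.posteriorProfile ρ n x).real {θ | √(n : ℝ) * (θ - a) * √I ≤ ξ} -
      cdf (gaussianReal 0 1) ξ| ≤ 2 * A * √I / (r * √(2 * Real.pi)) * (√(n : ℝ))⁻¹ := by
  have hn0 : (0 : ℝ) < n := by exact_mod_cast hn
  have hs : 0 < √(n : ℝ) := Real.sqrt_pos.2 hn0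
  have hsI : 0 < √I := Real.sqrt_pos.2 hI
  have hπ : 0 < √(2 * Real.pi) := Real.sqrt_pos.2 (by positivity)
  have hS : MeasurableSet {θ | √(n : ℝ) * (θ - a) * √I ≤ ξ} :=
    measurableSet_le (by fun_prop) measurable_const
  obtain ⟨hwi, hW, hwS⟩ := cdf_gaussianReal_eq_div (a := a) hn0 hI hr ξ
  have hW0 : 0 < r * √(2 * Real.pi) * (√(n : ℝ) * √I)⁻¹ := by positivity
  have hGi : Integrable (M.Θ.indicator g) := (integrable_indicator_iff hΘ).2 hgi
  have hdi := (hGi.sub hwi).abs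
  have hcdf := ((div_eq_iff hW0.ne').2 hwS).symm
  rw [hcdf, posteriorProfile_real hΘ hL hL' hg hg0 hgi hS]
  -- An `L¹` error `A / n` divided by the Gaussian mass `r √(2π) / √(nI)` is of order `n^{-1/2}`,
  -- independently of `ξ`.
  refine (abs_div_sub_div_le (D := A / n) (setIntegral_nonneg (hS.inter hΘ) fun θ hθ => hg0 θ hθ.2)
    (setIntegral_mono_set hgi ((ae_restrict_iff' hΘ).2 (ae_of_all _ hg0))
      (LE.le.eventuallyLE inter_subset_right)) hW0 ?_ ?_).trans_eq ?_
  · rw [← setIntegral_indicator hΘ, ← integral_sub hGi.integrableOn hwi.integrableOn]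
    refine (abs_integral_le_integral_abs).trans ((setIntegral_le_integral hdi ?_).trans hA)
    exact ae_of_all _ fun θ => abs_nonneg _
  · rw [← hW, ← integral_indicator hΘ, ← integral_sub hGi hwi]
    exact (abs_integral_le_integral_abs).trans hA
  · have hss : (n : ℝ) = √(n : ℝ) * √(n : ℝ) := (Real.mul_self_sqrt hn0.le).symm
    rw [show A / (n : ℝ) = A / (√(n : ℝ) * √(n : ℝ)) by rw [← hss]]
    field_simp

theorem lik_pos {n : ℕ} {x : Fin n → 𝒳} {t : ℝ} {η : E} (h : ∀ i, 0 < M.p t η (x i)) :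
    0 < M.lik n x t η :=
  Finset.prod_pos fun i _ => h i

namespace StandingAssumptions

variable {θ₀ : ℝ} {η₀ : E} {D : Set (ℝ → E)} {sub : ℝ → ℝ → E → E}
  {ηhat : (n : ℕ) → (Fin n → 𝒳) → ℝ → E}

theorem empMean_ell_zero {n : ℕ} {x : Fin n → 𝒳} {t θ : ℝ} {η : E}
    (h : ∀ i, 0 < M.p t (sub t θ η) (x i)) :
    empMean n x (M.ell sub 0 0 t θ η) = (n : ℝ)⁻¹ * Real.log (M.lik n x t (sub t θ η)) := by
  have h0 : ∀ i ∈ Finset.univ, (M.p t (sub t θ η) (x i) : ℝ) ≠ 0 := fun i _ => by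
    exact_mod_cast (h i).ne'
  simp only [empMean, ell_zero_zero, lik, NNReal.coe_prod]
  rw [Real.log_prod h0]

end StandingAssumptions

end SemiparametricModel

theorem exists_lipschitz_at {ρ : ℝ → ℝ} {θ₀ : ℝ} (h : DifferentiableAt ℝ ρ θ₀) :
    ∃ K δ : ℝ, 0 ≤ K ∧ 0 < δ ∧ ∀ θ, |θ - θ₀| < δ → |ρ θ - ρ θ₀| ≤ K * |θ - θ₀| := by
  obtain ⟨K, hK, hb⟩ := h.isBigO_sub.exists_nonneg
  obtain ⟨δ, hδ, hball⟩ := Metric.eventually_nhds_iff.1 hb.bound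
  exact ⟨K, δ, hK, hδ, fun θ hθ => hball (by rwa [Real.dist_eq])⟩

/-! ### The theorem. -/

theorem theorem2 {𝒳 : Type*} [MeasurableSpace 𝒳] {E : Type*} [NormedAddCommGroup E]
    (M : SemiparametricModel 𝒳 E) (θ₀ : ℝ) (η₀ : E) (D : Set (ℝ → E)) (sub : ℝ → ℝ → E → E)
    (ηhat : (n : ℕ) → (Fin n → 𝒳) → ℝ → E) (θhat : (n : ℕ) → (Fin n → 𝒳) → ℝ)
    (hM : M.StandingAssumptions θ₀ η₀ D sub ηhat)
    -- the maximum (profile) likelihood estimator of `θ`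
    (hθhat : ∀ᶠ n in atTop, ∀ᵐ x ∂sampleLaw (M.P θ₀ η₀) n, θhat n x ∈ M.Θ ∧
      ∀ θ ∈ M.Θ, M.profileLik n x θ ≤ M.profileLik n x (θhat n x))
    (hmeas : ∀ᶠ n in atTop, ∀ᵐ x ∂sampleLaw (M.P θ₀ η₀) n,
      AEMeasurable (M.profileLik n x) (volume.restrict M.Θ))
    -- identifiability
    (hident : ∀ θt : (n : ℕ) → (Fin n → 𝒳) → ℝ, (∀ n x, θt n x ∈ M.Θ) →
      IsLittleOP (M.P θ₀ η₀) (fun n x => (M.profileDelta n x (θhat n x) (θt n x)).abs) →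
      IsLittleOP (M.P θ₀ η₀) fun n x => ENNReal.ofReal |θt n x - θ₀|)
    -- the prior density on `Θ`
    (ρ : ℝ → ℝ≥0) (hρ_meas : Measurable ρ) (hρ_proper : ∫⁻ θ in M.Θ, (ρ θ : ℝ≥0∞) = 1)
    (hρ_pos : 0 < ρ θ₀) (hρ_smooth : ContDiffAt ℝ 1 (fun θ => (ρ θ : ℝ)) θ₀) :
    IsBigOP (M.P θ₀ η₀)
      (fun n x => ⨆ ξ : ℝ, ENNReal.ofReal
        |(M.posteriorProfile ρ n x).real
            {θ | √(n : ℝ) * (θ - θhat n x) * √(M.efficientInfo θ₀ η₀ D) ≤ ξ}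
          - cdf (gaussianReal 0 1) ξ|)
      fun n _ => (√(n : ℝ))⁻¹ := by
  intro ε hε
  have := hM.isProbabilityMeasure
  have hI := hM.info_pos
  set I := M.efficientInfo θ₀ η₀ D with hIdef
  have hr : (0 : ℝ) < ρ θ₀ := by exact_mod_cast hρ_pos
  have hΘm : MeasurableSet M.Θ := hM.isCompact_Θ.measurableSet
  obtain ⟨ε₀, hε₀, hΘ, hH, F, hF, hreg⟩ := hM.exists_regularAt
  obtain ⟨C, δ₀, hC, hδ₀, hδε, wexp⟩ :=
    hM.exists_score_expansion (ε := ε / 8) hε₀ hΘ hH hF hreg (by positivity)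
  obtain ⟨KW, hKW, wW⟩ := exists_abs_empMean_le hM.memLp_ell_one hM.integral_ell.1
    (ε := ε / 8) (by positivity)
  obtain ⟨Kρ, δρ, hKρ, hδρ, hlip⟩ :=
    exists_lipschitz_at (hρ_smooth.differentiableAt one_ne_zero)
  set B := 2 * KW / I + 1 / 2 with hB
  have hB0 : 0 ≤ B := by positivity
  set C' := 2 * C * (2 + 2 * B) ^ 2 with hC'
  have hC'0 : 0 < C' := by positivity
  -- The radius of the fixed neighbourhood carrying the Gaussian approximation; the last term makes
  -- the cubic error absorbable. The smaller `δ'` is the radius for consistency, at most `δ / 2` to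
  -- keep `θ̂` well inside.
  set δ := min δ₀ (min δρ (I / (48 * C'))) with hδdef
  have hδ : 0 < δ := by positivity
  have hδδ₀ : δ ≤ δ₀ := min_le_left _ _
  have hδδρ : δ ≤ δρ := (min_le_right _ _).trans (min_le_left _ _)
  have hCδ : C' * (3 * δ) ≤ I / 16 := by
    have h1 : δ ≤ I / (48 * C') := (min_le_right _ _).trans (min_le_right _ _)
    calc C' * (3 * δ) ≤ C' * (3 * (I / (48 * C'))) := by gcongr
      _ = I / 16 := by field_simp; norm_num
  set δ' := min (δ / 2) (I / (12 * C)) with hδ'def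
  have hδ' : 0 < δ' := by positivity
  have hδ'δ : δ' ≤ δ / 2 := min_le_left _ _
  have hCδ' : C * (3 * δ') ≤ I / 4 := by
    have h1 : δ' ≤ I / (12 * C) := min_le_right _ _
    calc C * (3 * δ') ≤ C * (3 * (I / (12 * C))) := by gcongr
      _ = I / 4 := by field_simp; norm_num
  have wcons := (hM.exists_identifiability_gap hθhat hident (ε := ε / 8) hδ' (by positivity)).1
  obtain ⟨c, hc, wgap⟩ :=
    (hM.exists_identifiability_gap hθhat hident (ε := ε / 8) hδ (by positivity)).2
  obtain ⟨A, hA, hL1⟩ := exists_integral_abs_sub_gaussian_le (θ₀ := θ₀) hI hr hKρ hB0 hC'0.le hc hδ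
    hCδ
  have hπ : 0 < √(2 * Real.pi) := Real.sqrt_pos.2 (by positivity)
  have hsI : 0 < √I := Real.sqrt_pos.2 hI
  refine ⟨2 * A * √I / (ρ θ₀ * √(2 * Real.pi)), by positivity, ?_⟩
  have hall := ((wexp.and (by positivity) (by positivity) wW).and (by positivity) (by positivity)
    wcons).and (by positivity) (by positivity) wgap
  have hall₁ := hall.and_ae (Eventually.of_forall fun n => ae_sampleLaw_forall hreg n)
  have hall₂ := ((hall₁.and_ae hM.ηhat_max).and_ae hθhat).and_ae hmeas
  have hall₃ := hall₂.and_ae (Eventually.of_forall hM.ae_profileLik_pos)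
  rw [show 5 * (ε / 8) + ε / 8 + ε / 8 + ε / 8 = ε by ring] at hall₃
  suffices hfinal : HoldsUpTo (M.P θ₀ η₀) ε fun n x => ∀ ξ : ℝ,
      |(M.posteriorProfile ρ n x).real {θ | √(n : ℝ) * (θ - θhat n x) * √I ≤ ξ}
        - cdf (gaussianReal 0 1) ξ| ≤ 2 * A * √I / (ρ θ₀ * √(2 * Real.pi)) * (√(n : ℝ))⁻¹ by
    filter_upwards [hfinal] with n hn
    refine (measure_mono (ofPred_subset_ofPred.2 fun x hx hcon => ?_)).trans hn
    exact hx.not_ge (iSup_le fun ξ => ENNReal.ofReal_le_ofReal (hcon ξ))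
  refine hall₃.mono ?_
  filter_upwards [eventually_ge_atTop 1, (tendsto_order.1 tendsto_inv_sqrt_atTop).2 δ' hδ']
    with n hn hnδ
  rintro x ⟨⟨⟨⟨⟨⟨⟨⟨hexp, hW⟩, hcons⟩, hgap⟩, hx⟩, hmax⟩, hhat⟩, hplm⟩, hpos⟩
  have hn0 : (0 : ℝ) < n := by exact_mod_cast hn
  set a := θhat n x with ha
  have hpl : ∀ θ ∈ M.Θ, M.profileLik n x θ = M.lik n x θ (ηhat n x θ) := fun θ hθ =>
    SemiparametricModel.StandingAssumptions.profileLik_eq hmax hθ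
  set L : ℝ≥0 := M.lik n x a (ηhat n x a) with hLdef
  have hplL : M.profileLik n x a = L := hpl a hhat.1
  have hL0 : 0 < L := by
    have := hpos.trans_le (hhat.2 θ₀ hM.mem_Θ)
    rw [hplL] at this
    exact_mod_cast this
  have hL0' : (0 : ℝ) < L := by exact_mod_cast hL0
  have hδΘ : ∀ t, |t - θ₀| < δ → t ∈ M.Θ := fun t ht => hΘ t (ht.trans_le (hδδ₀.trans hδε))
  have hle : ∀ {t}, |t - θ₀| < δ → |t - θ₀| < ε₀ := fun h => h.trans_le (hδδ₀.trans hδε)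
  -- the log-likelihood along the submodels
  have hppos : ∀ t θ, |t - θ₀| < δ → |θ - θ₀| < δ → ∀ i, 0 < M.p t (sub t θ (ηhat n x θ)) (x i) :=
    fun t θ ht hθ i => (hx i).pos t θ _ (hle ht) (hle hθ) (hmax θ (hδΘ θ hθ)).1
      (hexp θ (hθ.trans_le hδδ₀)).1
  have hval : ∀ t θ, |t - θ₀| < δ → |θ - θ₀| < δ →
      empMean n x (M.ell sub 0 0 t θ (ηhat n x θ)) =
        (n : ℝ)⁻¹ * Real.log (M.lik n x t (sub t θ (ηhat n x θ))) := fun t θ ht hθ =>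
    SemiparametricModel.StandingAssumptions.empMean_ell_zero (hppos t θ ht hθ)
  have hdiag : ∀ t, |t - θ₀| < δ → sub t t (ηhat n x t) = ηhat n x t := fun t ht =>
    hM.sub_diag t (hδΘ t ht) _ (hmax t (hδΘ t ht)).1
  have hvald : ∀ t, |t - θ₀| < δ → empMean n x (M.ell sub 0 0 t t (ηhat n x t)) =
      (n : ℝ)⁻¹ * Real.log (M.lik n x t (ηhat n x t)) ∧ 0 < M.lik n x t (ηhat n x t) := by
    intro t ht
    have h1 := hval t t ht ht
    have h2 := SemiparametricModel.lik_pos (hppos t t ht ht)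
    rw [hdiag t ht] at h1 h2
    exact ⟨h1, h2⟩
  have haδ : |a - θ₀| < δ := hcons.trans_le (by linarith)
  obtain ⟨hab, hquad⟩ := abs_profile_expansion_le
    (a := fun t θ => empMean n x (M.ell sub 0 0 t θ (ηhat n x θ)))
    (a' := fun t θ => empMean n x (M.ell sub 1 0 t θ (ηhat n x θ)))
    (θ₀ := θ₀) (δ := δ) (δ' := δ') (C := C) (K := KW) (I := I) (h := (√(n : ℝ))⁻¹) (θhat := a)
    (W := empMean n x (M.ell sub 1 0 θ₀ θ₀ η₀))
    hI hC.le hKW.le (by positivity) (by linarith) hCδ' hnδ.le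
    (fun t θ ht hθ => hasDerivAt_empMean (f := fun s => M.ell sub 0 0 s θ (ηhat n x θ))
      (f' := fun s => M.ell sub 1 0 s θ (ηhat n x θ)) fun i =>
      (hx i).left 0 (by norm_num) t θ _ (hle ht) (hle hθ) (hmax θ (hδΘ θ hθ)).1
        (hexp θ (hθ.trans_le hδδ₀)).1)
    (fun t θ ht hθ => (hexp θ (hθ.trans_le hδδ₀)).2 t (ht.trans_le hδδ₀))
    -- The submodel through `η̂_θ` stays in `M.H`, so its likelihood at `t` is at most the profile
    -- likelihood.
    (fun t θ ht hθ => by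
      rw [hval t θ ht hθ, (hvald t ht).1]
      refine mul_le_mul_of_nonneg_left (Real.log_le_log ?_ ?_) (by positivity)
      · exact_mod_cast SemiparametricModel.lik_pos (hppos t θ ht hθ)
      · exact_mod_cast (hmax t (hδΘ t ht)).2 _ (hH t θ _ (hle ht) (hle hθ) (hmax θ (hδΘ θ hθ)).1
          (hexp θ (hθ.trans_le hδδ₀)).1))
    hcons
    (fun t ht => by
      rw [(hvald t ht).1, (hvald a haδ).1]
      refine mul_le_mul_of_nonneg_left (Real.log_le_log ?_ ?_) (by positivity)
      · exact_mod_cast (hvald t ht).2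
      · have := hhat.2 t (hδΘ t ht)
        rw [hpl t (hδΘ t ht), hplL] at this
        exact_mod_cast this)
    hW
  -- the posterior density
  let u : ℝ → ℝ := fun θ => M.lik n x θ (ηhat n x θ) / L
  have hu0 : ∀ θ ∈ M.Θ, 0 ≤ u θ := fun θ _ => by positivity
  have hu1 : ∀ θ ∈ M.Θ, u θ ≤ 1 := fun θ hθ => by
    have h1 := hhat.2 θ hθ
    rw [hpl θ hθ, hplL] at h1
    exact div_le_one_of_le₀ (by exact_mod_cast h1) hL0'.le
  have hρ0 : ∀ θ, (0 : ℝ) ≤ ρ θ := fun θ => NNReal.coe_nonneg _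
  have hρm : AEStronglyMeasurable (fun θ => (ρ θ : ℝ)) (volume.restrict M.Θ) :=
    hρ_meas.coe_nnreal_real.aestronglyMeasurable
  have hρ1 : ∫ θ in M.Θ, (ρ θ : ℝ) = 1 := by
    rw [integral_eq_lintegral_of_nonneg_ae (ae_of_all _ hρ0) hρm]
    simp [hρ_proper]
  -- A non-integrable function would have Bochner integral `0`, not `1`.
  have hρi : IntegrableOn (fun θ => (ρ θ : ℝ)) M.Θ := by
    by_contra hcon
    rw [integral_undef hcon] at hρ1
    exact zero_ne_one hρ1
  have hui : IntegrableOn (fun θ => (ρ θ : ℝ) * u θ) M.Θ := by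
    have hum : AEStronglyMeasurable u (volume.restrict M.Θ) := by
      have h1 : AEStronglyMeasurable (fun θ => (M.profileLik n x θ).toReal * (L : ℝ)⁻¹)
        (volume.restrict M.Θ) := (hplm.ennreal_toReal.mul_const _).aestronglyMeasurable
      refine h1.congr ?_
      refine (ae_restrict_iff' hΘm).2 (ae_of_all _ fun θ hθ => ?_)
      simp only [u]
      rw [hpl θ hθ, div_eq_mul_inv]
      simp
    refine Integrable.mono' hρi (hρm.mul hum) ?_
    refine (ae_restrict_iff' hΘm).2 (ae_of_all _ fun θ hθ => ?_)
    rw [Real.norm_eq_abs, abs_of_nonneg (mul_nonneg (hρ0 θ) (hu0 θ hθ))]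
    exact mul_le_of_le_one_right (hρ0 θ) (hu1 θ hθ)
  have hfin := hL1 n M.Θ a (fun θ => ρ θ) u hn0 hΘm (by linarith) hab (by linarith) hρ0 hρi hρ1 hu0
    hui ?_ ?_
  · refine SemiparametricModel.abs_posteriorProfile_sub_cdf_le (L := L) hn hr hI hΘm (by exact_mod_cast hL0.ne')
      ENNReal.coe_ne_top ?_ (fun θ hθ => mul_nonneg (hρ0 θ) (hu0 θ hθ)) hui hfin
    intro θ hθ
    rw [hpl θ hθ, ENNReal.ofReal_mul (hρ0 θ), ENNReal.ofReal_coe_nnreal, mul_left_comm]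
    congr 1
    simp only [u]
    rw [← NNReal.coe_div, ENNReal.ofReal_coe_nnreal, ENNReal.coe_div hL0.ne',
      ENNReal.mul_div_cancel (by exact_mod_cast hL0.ne') ENNReal.coe_ne_top]
  · intro θ hθ
    refine ⟨hδΘ θ hθ, hlip θ (hθ.trans_le hδδρ),
      n * (empMean n x (M.ell sub 0 0 θ θ (ηhat n x θ)) -
        empMean n x (M.ell sub 0 0 a a (ηhat n x a)) + I / 2 * (θ - a) ^ 2), ?_, ?_⟩
    · rw [(hvald θ hθ).1, (hvald a haδ).1]
      have h1 : (0 : ℝ) < M.lik n x θ (ηhat n x θ) := by exact_mod_cast (hvald θ hθ).2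
      have h2 : -(n * I / 2 * (θ - a) ^ 2) +
          n * ((n : ℝ)⁻¹ * Real.log (M.lik n x θ (ηhat n x θ)) - (n : ℝ)⁻¹ * Real.log L +
            I / 2 * (θ - a) ^ 2) =
          Real.log (M.lik n x θ (ηhat n x θ)) - Real.log L := by
        field_simp; ring
      rw [h2, Real.exp_sub, Real.exp_log h1, Real.exp_log hL0']
    · rw [abs_mul, abs_of_pos hn0]
      exact mul_le_mul_of_nonneg_left (hquad θ hθ) hn0.le
  · intro θ hθ hθδ
    have h1 := hgap θ hθ hθδ
    rw [hpl θ hθ, hplL, ← ENNReal.ofReal_coe_nnreal, ← ENNReal.ofReal_coe_nnreal (p := L),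
      ← ENNReal.ofReal_mul (Real.exp_pos _).le,
      ENNReal.ofReal_le_ofReal_iff (by positivity)] at h1
    exact (div_le_iff₀ hL0').2 h1
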